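/- Let $E \subset \mathbb{P}^2$ be a smooth cubic curve in the complex projective plane. A rational curve of degree $d$ is an irreducible (reduced) plane curve of degree $d$ that is birational to $\mathbb{P}^1$; it meets $E$ at a single point if $C \cap E$, as a set, consists of exactly one point. Then there does not exist a positive-dimensional family of rational curves in $\mathbb{P}^2$ meeting $E$ at a single point. That is: let $B$ be an integral affine complex variety and let $F$ be a form of some degree $d$ in three variables with coefficients in the ring of regular functions on $B$, such that for every closed point $b \in B$ the curve $C_b = \{F_b = 0\}$ is a rational curve of degree $d$ meeting $E$ at a single point; then all the curves $C_b$ coincide (equivalently, the image of $B$ in the projective space of plane curves of degree $d$ is not positive-dimensional). Moreover, for every $d$ there are only finitely many rational curves of degree $d$ in $\mathbb{P}^2$ meeting $E$ at a single point. -/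

import Mathlib

namespace PlaneCurve

open MvPolynomial

/-- The complex projective plane, as the set of lines through the origin in `ℂ³`. -/
abbrev ProjPlane : Type := Projectivization ℂ (Fin 3 → ℂ)

/-- The zero locus in the projective plane of a form `F` in three variables. For homogeneous `F`
the choice of the representative is irrelevant, see `mk_mem_locus`. -/
def locus (F : MvPolynomial (Fin 3) ℂ) : Set ProjPlane :=
  {p | eval p.rep F = 0}

theorem eval_smul_of_isHomogeneous {F : MvPolynomial (Fin 3) ℂ} {d : ℕ} (hF : F.IsHomogeneous d)
    (c : ℂ) (v : Fin 3 → ℂ) : eval (c • v) F = c ^ d * eval v F := by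
  have h : (c • v : Fin 3 → ℂ) = fun i => c * v i := by
    funext i
    simp
  rw [h, eval_eq, eval_eq, Finset.mul_sum]
  refine Finset.sum_congr rfl fun m hm => ?_
  have hd : ∑ i ∈ m.support, m i = d := by
    have := hF (mem_support_iff.mp hm)
    rwa [Finsupp.weight_apply, Finsupp.sum, Finset.sum_congr rfl
      (fun i _ => by simp : ∀ i ∈ m.support, m i • (1 : Fin 3 → ℕ) i = m i)] at this
  simp only [mul_pow, Finset.prod_mul_distrib, Finset.prod_pow_eq_pow_sum, hd]
  ring

theorem mk_mem_locus {F : MvPolynomial (Fin 3) ℂ} {d : ℕ} (hF : F.IsHomogeneous d)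
    (v : Fin 3 → ℂ) (hv : v ≠ 0) : Projectivization.mk ℂ v hv ∈ locus F ↔ eval v F = 0 := by
  obtain ⟨a, ha⟩ := Projectivization.exists_smul_eq_mk_rep ℂ v hv
  have ha' : (a : ℂ) • v = (Projectivization.mk ℂ v hv).rep := ha
  simp only [locus, Set.mem_ofPred_eq]
  rw [← ha', eval_smul_of_isHomogeneous hF]
  simp

/-- `G` is an equation of a smooth plane cubic: a form of degree three whose partial derivatives
have no common zero on the curve `G = 0`. -/
structure IsSmoothCubic (G : MvPolynomial (Fin 3) ℂ) : Prop where
  isHomogeneous : G.IsHomogeneous 3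
  smooth : ∀ v : Fin 3 → ℂ, v ≠ 0 → eval v G = 0 → ∃ i, eval v (pderiv i G) ≠ 0

/-- `φ = (φ₀ : φ₁ : φ₂)` is a morphism from the projective line to the projective plane, given by
binary forms of the same degree without common zero, which is birational onto its image, and whose
image is `C`. -/
structure IsBirationalParametrization (φ : Fin 3 → MvPolynomial (Fin 2) ℂ) (C : Set ProjPlane) :
    Prop where
  exists_isHomogeneous : ∃ n : ℕ, ∀ i, (φ i).IsHomogeneous n
  no_common_zero : ∀ u : Fin 2 → ℂ, u ≠ 0 → (fun i => eval u (φ i)) ≠ 0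
  image_eq : C = {p | ∃ (u : Fin 2 → ℂ) (hu : u ≠ 0),
    p = Projectivization.mk ℂ (fun i => eval u (φ i)) (no_common_zero u hu)}
  /-- There is a rational map `(ψ₀ : ψ₁)` from the plane to the projective line, defined at the
  generic point of the image of `φ`, with `(ψ₀(φ) : ψ₁(φ)) = (X₀ : X₁)`. -/
  exists_inverse : ∃ (m : ℕ) (ψ : Fin 2 → MvPolynomial (Fin 3) ℂ),
    (∀ j, (ψ j).IsHomogeneous m) ∧ (∃ j, aeval φ (ψ j) ≠ 0) ∧
    aeval φ (ψ 0) * X 1 = aeval φ (ψ 1) * X 0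

/-- `F` is an equation of a rational plane curve of degree `d`: an irreducible form of degree `d`
whose zero locus is birational to the projective line. -/
structure IsRationalCurve (d : ℕ) (F : MvPolynomial (Fin 3) ℂ) : Prop where
  isHomogeneous : F.IsHomogeneous d
  irreducible : Irreducible F
  exists_parametrization : ∃ φ, IsBirationalParametrization φ (locus F)

/-- The curves `F = 0` and `G = 0` have exactly one common point (no condition is imposed on the
number of branches of the curves at that point). -/
def MeetAtSinglePoint (F G : MvPolynomial (Fin 3) ℂ) : Prop :=
  ∃ p : ProjPlane, locus F ∩ locus G = {p}

/-- An algebraic family of plane curves of degree `d` over the affine variety with coordinate ring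
`A`: a form of degree `d` in three variables whose coefficients are regular functions on the
base. -/
structure Family (d : ℕ) (A : Type*) [CommRing A] where
  form : MvPolynomial (Fin 3) A
  isHomogeneous : form.IsHomogeneous d

/-- The equation of the member of the family over the closed point `b` of the base. -/
noncomputable def Family.member {d : ℕ} {A : Type*} [CommRing A] [Algebra ℂ A] (S : Family d A)
    (b : A →ₐ[ℂ] ℂ) : MvPolynomial (Fin 3) ℂ :=
  map (b : A →+* ℂ) S.form

/-- A family over an irreducible base is positive-dimensional if its members are not all the same
curve; equivalently the image of the base in the projective space of plane curves of degree `d`,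
which is irreducible, has positive dimension. -/
def Family.IsPositiveDimensional {d : ℕ} {A : Type*} [CommRing A] [Algebra ℂ A]
    (S : Family d A) : Prop :=
  ∃ b₁ b₂ : A →ₐ[ℂ] ℂ, locus (S.member b₁) ≠ locus (S.member b₂)

end PlaneCurve

/-!
A family of rational curves is treated through a single curve over a large field `K ⊇ ℂ` together
with a derivation `D` of `K` over `ℂ`, which plays the role of a tangent direction of the base.

Let `φ = (φ₀, φ₁, φ₂)` be polynomials over `K` parametrizing a curve which meets the cubic `G = 0`
only at `p`. The pullback to the family of the two-form with a logarithmic pole along the cubic is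
`N / G(φ) ds`, where `N = det (φ, φ', D φ)`. At a root of `G(φ)` it has at most a simple pole, and
its residue is the multiplicity of the root times `-c`, where `p × D p = c ∇G(p)`: the number `c`
is the value of the invariant differential of the cubic along the motion of `p`, so it is the same
for all the roots. There are `3n` roots with multiplicity and the residues add up to zero, whence
`c = 0`; now the form has no poles, and as the projective line carries no regular one-form,
`N = 0`. In polynomial terms, `G(φ)` divides `N + c G(φ)'`, and `N` has degree at most
`3n - 2` (`X_sub_C_pow_dvd`, `triple_eq_zero`). So `D φ` is a combination of `φ` and `φ'`, the
curve moves only along itself, and if `F(φ) = 0` then also `(D F)(φ) = 0`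
(`aeval_mvCoeffs_eq_zero`).

For the finiteness statement, infinitely many curves of degree `d` would give a sequence of distinct
normalized equations, and so one equation over an ultrapower `K` of `ℂ` with a coefficient outside
`ℂ`. This coefficient is transcendental over `ℂ`, hence not killed by some derivation `D`
(`exists_derivation_ne_zero_of_transcendental`). But `D F` vanishes on the curve `F = 0` and lacks
the monomial in which `F` was normalized, so it is the zero multiple of `F`
(`not_injective_of_isAffineParametrization`). To form the ultraproduct the parametrizations must
have bounded degree; by birationality, and by counting the intersections with a general line, the
degree of the parametrization is at most `d` (`le_of_generically_injective`).

The statement on families follows: over an irreducible base, one of the finitely many closed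
conditions "the member is the curve `C`" holds everywhere (`not_isPositiveDimensional`).
-/

namespace PlaneCurve

/-! ### Pencils of polynomials without base points -/

section Pencil

open Polynomial

/-- Only finitely many members of a pencil without base points and of degree `n > 0` have a
multiple root, have degree less than `n`, or share a root with a given polynomial `b`. -/
theorem exists_nodup_roots_add_C_mul {K : Type*} [Field K] [IsAlgClosed K] [CharZero K] {n : ℕ}
    (hn : 0 < n) {P Q b : K[X]} (hP : P.natDegree ≤ n) (hQ : Q.natDegree ≤ n)
    (htop : P.coeff n ≠ 0 ∨ Q.coeff n ≠ 0) (hPQ : ∀ a, P.eval a ≠ 0 ∨ Q.eval a ≠ 0)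
    (hb : b ≠ 0) :
    ∃ c : K, (P + C c * Q).natDegree = n ∧ (P + C c * Q).roots.Nodup ∧
      ∀ a ∈ (P + C c * Q).roots, ¬ b.IsRoot a := by
  classical
  have hcop : IsCoprime P Q := by
    rw [isCoprime_iff_aeval_ne_zero_of_isAlgClosed K K]
    simpa using hPQ
  -- A multiple root of a member of the pencil is a root of the Wronskian `W`.
  set W := P * derivative Q - Q * derivative P with hW
  have hW0 : W ≠ 0 := by
    intro h
    have h1 : derivative P = 0 := by
      rw [← dvd_derivative_iff]
      refine hcop.dvd_of_dvd_mul_left ⟨derivative Q, ?_⟩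
      linear_combination -h
    have h2 : derivative Q = 0 := by
      rw [← dvd_derivative_iff]
      refine hcop.symm.dvd_of_dvd_mul_left ⟨derivative P, ?_⟩
      linear_combination h
    have h3 := derivative_eq_zero.1 h1
    have h4 := derivative_eq_zero.1 h2
    rw [coeff_eq_zero_of_natDegree_lt (by omega), coeff_eq_zero_of_natDegree_lt (by omega)] at htop
    tauto
  have hlin {x y : K} (h : x ≠ 0 ∨ y ≠ 0) : C x + C y * X ≠ 0 := by
    intro h0
    have hx := congrArg (fun f => coeff f 0) h0
    have hy := congrArg (fun f => coeff f 1) h0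
    simp [coeff_C] at hx hy
    tauto
  -- The parameters to be avoided are the roots of `E`.
  set E : K[X] := (C (P.coeff n) + C (Q.coeff n) * X) *
    ∏ a ∈ (W * b).roots.toFinset, (C (P.eval a) + C (Q.eval a) * X) with hE
  have hE0 : E ≠ 0 := mul_ne_zero (hlin htop) (Finset.prod_ne_zero_iff.2 fun a _ => hlin (hPQ a))
  obtain ⟨c, hc⟩ : ∃ c, E.eval c ≠ 0 := by
    by_contra! h
    exact hE0 (Polynomial.funext fun c => by simp [h c])
  rw [hE, eval_mul, eval_prod] at hc
  have hc1 : (P + C c * Q).coeff n ≠ 0 := by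
    have := left_ne_zero_of_mul hc
    rwa [eval_add, eval_mul, eval_C, eval_C, eval_X, mul_comm, ← coeff_C_mul, ← coeff_add] at this
  have hc2 (a : K) (ha : (W * b).IsRoot a) : ¬ (P + C c * Q).IsRoot a := by
    have := Finset.prod_ne_zero_iff.1 (right_ne_zero_of_mul hc) a
      (by rw [Multiset.mem_toFinset, mem_roots (mul_ne_zero hW0 hb)]; exact ha)
    rwa [eval_add, eval_mul, eval_C, eval_C, eval_X, mul_comm, ← eval_C_mul, ← eval_add] at this
  have hT0 : P + C c * Q ≠ 0 := fun h => hc1 (by simp [h])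
  refine ⟨c, le_antisymm ?_ (le_natDegree_of_ne_zero hc1), ?_, fun a ha hba => ?_⟩
  · exact (natDegree_add_le_of_degree_le hP ((natDegree_C_mul_le _ _).trans hQ))
  · rw [Multiset.nodup_iff_count_le_one]
    intro a
    rw [count_roots]
    by_contra! h
    obtain ⟨h0, h1⟩ := (one_lt_rootMultiplicity_iff_isRoot hT0).1 h
    refine hc2 a ?_ h0
    simp [IsRoot.def] at h0 h1
    simp [hW, IsRoot.def]
    left
    linear_combination (derivative Q).eval a * h0 - Q.eval a * h1
  · refine hc2 a ?_ ((mem_roots hT0).1 ha)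
    simp [IsRoot.def] at hba
    simp [IsRoot.def, hba]

end Pencil

open MvPolynomial
open scoped Matrix Polynomial TensorProduct

/-! ### Derivations of field extensions -/

/-- Derivations extend along formally étale algebras, since the differentials of the extension
are obtained by base change. -/
theorem exists_derivation_extension_of_formallyEtale {k A K : Type*} [CommRing k] [CommRing A]
    [CommRing K] [Algebra k A] [Algebra A K] [Algebra k K] [IsScalarTower k A K]
    [Algebra.FormallyEtale A K] (D₀ : Derivation k A K) :
    ∃ D : Derivation k K K, ∀ a, D (algebraMap A K a) = D₀ a := by
  let f : Ω[K⁄k] →ₗ[K] K := (D₀.liftKaehlerDifferential.liftBaseChange K).comp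
    (KaehlerDifferential.tensorKaehlerEquivOfFormallyEtale k A K).symm.toLinearMap
  refine ⟨f.compDer (KaehlerDifferential.D k K), fun a => ?_⟩
  change D₀.liftKaehlerDifferential.liftBaseChange K
    ((KaehlerDifferential.tensorKaehlerEquivOfFormallyEtale k A K).symm
      (KaehlerDifferential.D k K (algebraMap A K a))) = D₀ a
  rw [KaehlerDifferential.tensorKaehlerEquivOfFormallyEtale_symm_D_algebraMap]
  simp

/-- In characteristic zero, derivations detect transcendental elements: a transcendence basis
containing `c` makes `K` formally étale over a polynomial ring in which `c` is a variable, and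
`∂/∂c` extends. -/
theorem exists_derivation_ne_zero_of_transcendental {k K : Type*} [Field k] [CharZero k] [Field K]
    [Algebra k K] {c : K} (hc : Transcendental k c) : ∃ D : Derivation k K K, D c ≠ 0 := by
  have hind : AlgebraicIndepOn k id ({c} : Set K) :=
    (algebraicIndependent_unique_type_iff (ι := ({c} : Set K)) (R := k)
      (x := fun i => (i : K))).2 (by simpa using hc)
  obtain ⟨s, hcs, hs⟩ := exists_isTranscendenceBasis_superset hind
  have hcs' : c ∈ s := hcs rfl
  let A := MvPolynomial s k
  let φ : A →ₐ[k] K := MvPolynomial.aeval (fun i : s => (i : K))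
  let _ : Algebra A K := φ.toAlgebra
  have : IsScalarTower k A K := IsScalarTower.of_algebraMap_eq' φ.comp_algebraMap.symm
  have : FaithfulSMul A K := (faithfulSMul_iff_algebraMap_injective A K).2 hs.1
  have : Algebra.IsAlgebraic A K := by
    have := hs.isAlgebraic
    exact Algebra.IsAlgebraic.of_ringHom_of_comp_eq hs.1.aevalEquiv (RingHom.id K)
      hs.1.aevalEquiv.surjective Function.injective_id
      (RingHom.ext fun x => hs.1.algebraMap_aevalEquiv x)
  have : CharZero K := charZero_of_injective_algebraMap (algebraMap k K).injective
  have : CharZero (FractionRing A) :=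
    charZero_of_injective_algebraMap (algebraMap k (FractionRing A)).injective
  let _ := FractionRing.liftAlgebra A K
  have : Algebra.IsAlgebraic (FractionRing A) K :=
    (IsFractionRing.comap_isAlgebraic_iff (A := A) (K := FractionRing A)).1 inferInstance
  have : Algebra.FormallyEtale (FractionRing A) K := Algebra.FormallyEtale.of_isSeparable _ _
  have : Algebra.FormallyEtale A (FractionRing A) :=
    Algebra.FormallyEtale.of_isLocalization (nonZeroDivisors A)
  have : Algebra.FormallyEtale A K := Algebra.FormallyEtale.comp A (FractionRing A) K
  classical
  obtain ⟨D, hD⟩ := exists_derivation_extension_of_formallyEtale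
    (mkDerivation k (Pi.single (⟨c, hcs'⟩ : s) (1 : K)) : Derivation k A K)
  refine ⟨D, ?_⟩
  have hcx : φ (X ⟨c, hcs'⟩) = c := MvPolynomial.aeval_X _ _
  rw [← hcx]
  refine (hD _).trans_ne ?_
  rw [mkDerivation_X, Pi.single_eq_same]
  exact one_ne_zero

/-! ### Derivations acting on coefficients, and cross products -/

section Derivations

variable {k K : Type*} [CommRing k] [Field K] [Algebra k K] (D : Derivation k K K)

/-- The derivation of `K[X]` that applies `D` to the coefficients. -/
noncomputable def polyCoeffs : Derivation k K[X] K[X] :=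
  PolynomialModule.equivPolynomialSelf.compDer D.mapCoeffs

theorem coeff_polyCoeffs (f : K[X]) (i : ℕ) : (polyCoeffs D f).coeff i = D (f.coeff i) := rfl

theorem polyCoeffs_C (a : K) : polyCoeffs D (Polynomial.C a) = Polynomial.C (D a) := by
  ext i
  rw [coeff_polyCoeffs, Polynomial.coeff_C, Polynomial.coeff_C]
  split_ifs <;> simp

theorem polyCoeffs_X : polyCoeffs D Polynomial.X = 0 := by
  ext i
  rw [coeff_polyCoeffs, Polynomial.coeff_X, Polynomial.coeff_zero]
  split_ifs <;> simp

theorem natDegree_polyCoeffs_le (f : K[X]) : (polyCoeffs D f).natDegree ≤ f.natDegree := by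
  refine Polynomial.natDegree_le_iff_coeff_eq_zero.2 fun i hi => ?_
  rw [coeff_polyCoeffs, Polynomial.coeff_eq_zero_of_natDegree_lt hi, map_zero]

theorem derivation_eval (f : K[X]) (a : K) :
    D (f.eval a) = (polyCoeffs D f).eval a + f.derivative.eval a * D a := by
  induction f using Polynomial.induction_on' with
  | add p q hp hq => simp only [Polynomial.eval_add, map_add, hp, hq]; ring
  | monomial m b =>
    rw [← Polynomial.C_mul_X_pow_eq_monomial]
    simp only [Derivation.leibniz, Derivation.leibniz_pow, polyCoeffs_C, polyCoeffs_X,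
      Polynomial.eval_mul, Polynomial.eval_C, Polynomial.eval_pow, Polynomial.eval_X,
      Polynomial.derivative_mul, Polynomial.derivative_C, Polynomial.derivative_X_pow, smul_eq_mul,
      nsmul_eq_mul, Polynomial.eval_add, Polynomial.eval_natCast, map_natCast]
    simp
    ring

/-- The polynomial obtained by applying `D` to the coefficients of a polynomial in several
variables. -/
noncomputable def mvCoeffs {σ : Type*} (P : MvPolynomial σ K) : MvPolynomial σ K :=
  ∑ m ∈ P.support, monomial m (D (coeff m P))

theorem coeff_mvCoeffs {σ : Type*} (P : MvPolynomial σ K) (m : σ →₀ ℕ) :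
    coeff m (mvCoeffs D P) = D (coeff m P) := by
  classical
  rw [mvCoeffs, coeff_sum]
  simp only [coeff_monomial]
  rw [Finset.sum_ite_eq']
  split_ifs with h
  · rfl
  · rw [notMem_support_iff.1 h, map_zero]

theorem mvCoeffs_add {σ : Type*} (P Q : MvPolynomial σ K) :
    mvCoeffs D (P + Q) = mvCoeffs D P + mvCoeffs D Q := by
  ext m
  simp only [coeff_mvCoeffs, coeff_add, map_add]

theorem mvCoeffs_C {σ : Type*} (a : K) :
    mvCoeffs D (C a : MvPolynomial σ K) = C (D a) := by
  classical
  ext m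
  simp only [coeff_mvCoeffs, coeff_C]
  split_ifs <;> simp

theorem mvCoeffs_mul_X {σ : Type*} (P : MvPolynomial σ K) (i : σ) :
    mvCoeffs D (P * X i) = mvCoeffs D P * X i := by
  classical
  ext m
  simp only [coeff_mvCoeffs, coeff_mul_X']
  split_ifs <;> simp

theorem isHomogeneous_mvCoeffs {σ : Type*} {P : MvPolynomial σ K} {d : ℕ}
    (hP : P.IsHomogeneous d) : (mvCoeffs D P).IsHomogeneous d := by
  intro m hm
  refine hP fun h => hm ?_
  rw [coeff_mvCoeffs, h, map_zero]

/-- The chain rule for the composition of a polynomial `P` with a polynomial path `φ`, for any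
derivation `E` of `K[X]` extending `D`. -/
theorem derivation_aeval {σ : Type*} [Fintype σ] (E : Derivation k K[X] K[X])
    (hE : ∀ a, E (Polynomial.C a) = Polynomial.C (D a)) (φ : σ → K[X]) (P : MvPolynomial σ K) :
    E (aeval φ P) = aeval φ (mvCoeffs D P) + ∑ i, aeval φ (pderiv i P) * E (φ i) := by
  classical
  induction P using MvPolynomial.induction_on with
  | C a => simp [mvCoeffs_C, hE, -Polynomial.algebraMap_apply]
  | add P Q hP hQ =>
    simp only [map_add, hP, hQ, mvCoeffs_add, add_mul, Finset.sum_add_distrib]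
    ring
  | mul_X P j hP =>
    have hsum : ∑ i, aeval φ (pderiv i (P * X j)) * E (φ i) =
        (∑ i, aeval φ (pderiv i P) * E (φ i)) * φ j + aeval φ P * E (φ j) := by
      have h (i : σ) : aeval φ (pderiv i (P * X j)) * E (φ i) =
          aeval φ (pderiv i P) * E (φ i) * φ j + if i = j then aeval φ P * E (φ i) else 0 := by
        split_ifs with hij
        · subst hij
          simp
          ring
        · simp [pderiv_X_of_ne (Ne.symm hij)]
          ring
      rw [Finset.sum_congr rfl fun i _ => h i]
      simp [Finset.sum_add_distrib, Finset.sum_mul]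
    rw [hsum, mvCoeffs_mul_X]
    simp only [map_mul, aeval_X, Derivation.leibniz, hP, smul_eq_mul]
    ring

end Derivations

theorem eval_mul_of_isHomogeneous {σ R : Type*} [CommRing R] {F : MvPolynomial σ R}
    {d : ℕ} (hF : F.IsHomogeneous d) (c : R) (v : σ → R) :
    eval (fun i => c * v i) F = c ^ d * eval v F := by
  rw [eval_eq, eval_eq, Finset.mul_sum]
  refine Finset.sum_congr rfl fun m hm => ?_
  simp only [mul_pow, Finset.prod_mul_distrib, Finset.prod_pow_eq_pow_sum,
    ← hF.degree_eq_sum_deg_support hm]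
  ring

section Cross

variable {R : Type*} [CommRing R]

/-- Cramer's rule: the expansion of `v` in terms of three vectors, given its inner products with
them. -/
theorem triple_mul_apply (x y z v : Fin 3 → R) (i : Fin 3) :
    (x ⬝ᵥ y ⨯₃ z) * v i =
      (v ⬝ᵥ x) * (y ⨯₃ z) i + (v ⬝ᵥ y) * (z ⨯₃ x) i + (v ⬝ᵥ z) * (x ⨯₃ y) i := by
  simp only [cross_apply, Matrix.vec3_dotProduct]
  fin_cases i <;> simp <;> ring

theorem cross_cross_apply (v x y : Fin 3 → R) (i : Fin 3) :
    (v ⨯₃ (x ⨯₃ y)) i = (v ⬝ᵥ y) * x i - (v ⬝ᵥ x) * y i := by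
  simp only [cross_apply, Matrix.vec3_dotProduct]
  fin_cases i <;> simp <;> ring

theorem exists_cross_eq_smul {K : Type*} [Field K] {v x y : Fin 3 → K} (hv : ∃ i, v i ≠ 0)
    (hx : v ⬝ᵥ x = 0) (hy : v ⬝ᵥ y = 0) : ∃ c : K, ∀ i, (x ⨯₃ y) i = c * v i := by
  obtain ⟨j, hj⟩ := hv
  have h : v ⨯₃ (x ⨯₃ y) = 0 := by
    ext i
    rw [cross_cross_apply, hx, hy]
    simp
  have h0 := congrFun h 0
  have h1 := congrFun h 1
  have h2 := congrFun h 2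
  refine ⟨(x ⨯₃ y) j / v j, fun i => ?_⟩
  generalize x ⨯₃ y = w at *
  simp [cross_apply] at h0 h1 h2
  rw [div_mul_eq_mul_div, eq_div_iff hj]
  have H : ∀ i j : Fin 3, w i * v j = w j * v i := by
    simp only [Fin.forall_fin_succ, Fin.isValue]
    simp
    grind
  exact H i j

end Cross

/-! ### The logarithmic two-form along a path -/

/-- The gradient of `P` along the polynomial path `φ`. -/
noncomputable def gradAlong {K : Type*} [Field K] (P : MvPolynomial (Fin 3) K)
    (φ : Fin 3 → K[X]) : Fin 3 → K[X] := fun i => aeval φ (pderiv i P)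

section Core

variable {k K : Type*} [CommRing k] [Field K] [Algebra k K] (D : Derivation k K K)

theorem gradAlong_dotProduct_self {P : MvPolynomial (Fin 3) K} {d : ℕ} (hP : P.IsHomogeneous d)
    (φ : Fin 3 → K[X]) : gradAlong P φ ⬝ᵥ φ = d * aeval φ P := by
  have h := congrArg (aeval φ) hP.sum_X_mul_pderiv
  simp only [map_sum, map_mul, aeval_X, nsmul_eq_mul, map_natCast] at h
  rw [← h]
  simp [dotProduct, gradAlong, mul_comm]

theorem gradAlong_dotProduct_derivative (P : MvPolynomial (Fin 3) K) (φ : Fin 3 → K[X]) :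
    gradAlong P φ ⬝ᵥ (fun i => Polynomial.derivative (φ i)) =
      Polynomial.derivative (aeval φ P) := by
  have h := derivation_aeval (0 : Derivation ℤ K K) (Polynomial.derivative'.restrictScalars ℤ)
    (by simp) φ P
  have h0 : mvCoeffs (0 : Derivation ℤ K K) P = 0 := by
    ext m
    simp [coeff_mvCoeffs]
  rw [h0, map_zero, zero_add] at h
  exact h.symm

theorem gradAlong_dotProduct_polyCoeffs (P : MvPolynomial (Fin 3) K) (φ : Fin 3 → K[X]) :
    gradAlong P φ ⬝ᵥ (fun i => polyCoeffs D (φ i)) =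
      polyCoeffs D (aeval φ P) - aeval φ (mvCoeffs D P) := by
  rw [derivation_aeval D (polyCoeffs D) (polyCoeffs_C D) φ P]
  simp [dotProduct, gradAlong]

theorem eval_aeval {σ R : Type*} [CommRing R] (P : MvPolynomial σ R) (φ : σ → R[X]) (a : R) :
    (aeval φ P).eval a = eval (fun j => (φ j).eval a) P := by
  induction P using MvPolynomial.induction_on with
  | C b => simp
  | add P Q hP hQ => simp [hP, hQ]
  | mul_X P j hP => simp [hP]

theorem eval_gradAlong (P : MvPolynomial (Fin 3) K) (φ : Fin 3 → K[X]) (a : K) (i : Fin 3) :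
    (gradAlong P φ i).eval a = eval (fun j => (φ j).eval a) (pderiv i P) := by
  rw [gradAlong, eval_aeval]

theorem eval_cross (x y : Fin 3 → K[X]) (a : K) (i : Fin 3) :
    ((x ⨯₃ y) i).eval a = ((fun j => (x j).eval a) ⨯₃ (fun j => (y j).eval a)) i := by
  simp only [cross_apply]
  fin_cases i <;> simp

theorem exists_eq_mul_of_X_sub_C_pow_dvd {g : K[X]} {a : K} {l : ℕ}
    (h : (Polynomial.X - Polynomial.C a) ^ (l + 1) ∣ g) :
    ∃ u : K[X], ∃ u₁ u₂ : K[X], g = (Polynomial.X - Polynomial.C a) ^ (l + 1) * u ∧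
      Polynomial.derivative g = ((l : K[X]) + 1) * (Polynomial.X - Polynomial.C a) ^ l * u +
        (Polynomial.X - Polynomial.C a) ^ (l + 1) * u₁ ∧
      polyCoeffs D g =
        - (Polynomial.C (D a) * (((l : K[X]) + 1) * (Polynomial.X - Polynomial.C a) ^ l * u)) +
        (Polynomial.X - Polynomial.C a) ^ (l + 1) * u₂ := by
  obtain ⟨u, rfl⟩ := h
  refine ⟨u, Polynomial.derivative u, polyCoeffs D u, rfl, ?_, ?_⟩
  · simp [Polynomial.derivative_pow]
  · rw [Derivation.leibniz, Derivation.leibniz_pow, map_sub, polyCoeffs_X, polyCoeffs_C]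
    simp only [smul_eq_mul, nsmul_eq_mul, Nat.add_sub_cancel]
    push_cast
    ring

/-- The local computation at a point `a` where the path `φ` meets the cubic to order `l`: the
logarithmic form has at most a simple pole there, with residue `-l c`. The hypothesis on `c` says
that `c` is the value of the invariant differential of the cubic along the motion of the point
`φ a`. -/
theorem X_sub_C_pow_dvd {G : MvPolynomial (Fin 3) K} (hG : G.IsHomogeneous 3)
    (hGD : mvCoeffs D G = 0) (φ : Fin 3 → K[X]) {a c : K} {l : ℕ}
    (hl : (Polynomial.X - Polynomial.C a) ^ l ∣ aeval φ G)
    (hsm : ∃ i, eval (fun j => (φ j).eval a) (pderiv i G) ≠ 0)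
    (hc : ∀ i, ((fun j => (φ j).eval a) ⨯₃ (fun j => D ((φ j).eval a))) i =
      c * eval (fun j => (φ j).eval a) (pderiv i G)) :
    (Polynomial.X - Polynomial.C a) ^ l ∣
      φ ⬝ᵥ (fun i => Polynomial.derivative (φ i)) ⨯₃ (fun i => polyCoeffs D (φ i)) +
      Polynomial.C c * Polynomial.derivative (aeval φ G) := by
  obtain ⟨i, hi⟩ := hsm
  rw [← eval_gradAlong] at hi
  have hcop : IsCoprime ((Polynomial.X - Polynomial.C a) ^ l) (gradAlong G φ i) := by
    refine IsCoprime.pow_left ?_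
    rw [(Polynomial.irreducible_X_sub_C a).coprime_iff_not_dvd, Polynomial.dvd_iff_isRoot]
    exact hi
  refine hcop.dvd_of_dvd_mul_right ?_
  rw [add_mul, triple_mul_apply, gradAlong_dotProduct_self hG, gradAlong_dotProduct_derivative,
    gradAlong_dotProduct_polyCoeffs, hGD, map_zero, sub_zero]
  obtain _ | l := l
  · simp
  obtain ⟨u, u₁, u₂, h, h₁, h₂⟩ := exists_eq_mul_of_X_sub_C_pow_dvd D hl
  rw [h₁, h₂, h]
  set x := φ
  set y : Fin 3 → K[X] := fun i => Polynomial.derivative (φ i)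
  set z : Fin 3 → K[X] := fun i => polyCoeffs D (φ i)
  set v := gradAlong G φ
  -- The cofactor of `(X - a) ^ l` vanishes at `a`, by the chain rule for `D (φ a)`.
  have hB : (Polynomial.X - Polynomial.C a) ∣
      (z ⨯₃ x) i - Polynomial.C (D a) * (x ⨯₃ y) i + Polynomial.C c * v i := by
    rw [Polynomial.dvd_iff_isRoot, Polynomial.IsRoot.def]
    have := hc i
    simp only [derivation_eval] at this
    simp only [Polynomial.eval_add, Polynomial.eval_sub, Polynomial.eval_mul, Polynomial.eval_C,
      eval_cross, v, eval_gradAlong, ← this, x, y, z]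
    simp only [cross_apply]
    clear_value x y z v
    fin_cases i <;> simp <;> ring
  obtain ⟨w, hw⟩ := hB
  set t := Polynomial.X - Polynomial.C a
  refine ⟨3 * u * (y ⨯₃ z) i + u₁ * (z ⨯₃ x) i + u₂ * (x ⨯₃ y) i + Polynomial.C c * u₁ * v i +
    (l + 1) * u * w, ?_⟩
  push_cast
  linear_combination (l + 1) * t ^ l * u * hw

theorem natDegree_cross_le {x y : Fin 3 → K[X]} {m n : ℕ} (hx : ∀ i, (x i).natDegree ≤ m)
    (hy : ∀ i, (y i).natDegree ≤ n) (i : Fin 3) : ((x ⨯₃ y) i).natDegree ≤ m + n := by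
  have h (i j) : (x i * y j).natDegree ≤ m + n := Polynomial.natDegree_mul_le_of_le (hx i) (hy j)
  have h' (i j k l) : (x i * y j - x k * y l).natDegree ≤ m + n :=
    (Polynomial.natDegree_sub_le_of_le (h i j) (h k l)).trans (max_self _).le
  simp only [cross_apply]
  fin_cases i
  · exact h' 1 2 2 1
  · exact h' 2 0 0 2
  · exact h' 0 1 1 0

theorem natDegree_dotProduct_le {x y : Fin 3 → K[X]} {m n : ℕ} (hx : ∀ i, (x i).natDegree ≤ m)
    (hy : ∀ i, (y i).natDegree ≤ n) : (x ⬝ᵥ y).natDegree ≤ m + n :=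
  Polynomial.natDegree_sum_le_of_forall_le _ _ fun i _ =>
    Polynomial.natDegree_mul_le_of_le (hx i) (hy i)

/-- The leading terms in `φ ⬝ᵥ φ' ⨯₃ z` cancel: up to the factor `n`, one may replace `φ` by
`n φ - X φ'`, which has smaller degree. -/
theorem natDegree_triple_lt [CharZero K] {n : ℕ} (hn : 0 < n) {φ z : Fin 3 → K[X]}
    (hφ : ∀ i, (φ i).natDegree ≤ n) (hz : ∀ i, (z i).natDegree ≤ n) :
    (φ ⬝ᵥ (fun i => Polynomial.derivative (φ i)) ⨯₃ z).natDegree < 3 * n - 1 := by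
  set y : Fin 3 → K[X] := fun i => Polynomial.derivative (φ i) with hy
  set x : Fin 3 → K[X] := fun i => Polynomial.C (n : K) * φ i - Polynomial.X * y i with hx
  have hyn : ∀ i, (y i).natDegree ≤ n - 1 := fun i =>
    (Polynomial.natDegree_derivative_le _).trans (Nat.sub_le_sub_right (hφ i) 1)
  have hxn : ∀ i, (x i).natDegree ≤ n - 1 := fun i => by
    refine Polynomial.natDegree_le_iff_coeff_eq_zero.2 fun j hj => ?_
    obtain ⟨j, rfl⟩ : ∃ j', j = j' + 1 := ⟨j - 1, by omega⟩
    simp only [hx, hy, Polynomial.coeff_sub, Polynomial.coeff_C_mul, Polynomial.coeff_X_mul,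
      Polynomial.coeff_derivative]
    obtain h | h : j + 1 = n ∨ n < j + 1 := by omega
    · rw [← h]
      push_cast
      ring
    · rw [Polynomial.coeff_eq_zero_of_natDegree_lt ((hφ i).trans_lt h)]
      simp
  have h : Polynomial.C (n : K) * (φ ⬝ᵥ y ⨯₃ z) = x ⬝ᵥ y ⨯₃ z := by
    simp only [Matrix.vec3_dotProduct, cross_apply, hx]
    simp
    ring
  have hle := natDegree_dotProduct_le hxn (natDegree_cross_le hyn hz)
  rw [← h, Polynomial.natDegree_C_mul (Nat.cast_ne_zero.2 hn.ne')] at hle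
  omega

theorem dvd_of_forall_X_sub_C_pow_dvd {g f : K[X]} (hg : g.Splits) (hg0 : g ≠ 0)
    (h : ∀ a, (Polynomial.X - Polynomial.C a) ^ g.rootMultiplicity a ∣ f) : g ∣ f := by
  classical
  obtain rfl | hf := eq_or_ne f 0
  · exact dvd_zero g
  · refine hg.dvd_of_roots_le_roots hg0 (Multiset.le_iff_count.2 fun a => ?_)
    rw [Polynomial.count_roots, Polynomial.count_roots]
    exact (Polynomial.le_rootMultiplicity_iff hf).2 (h a)

/-- A path whose values at the points of a smooth cubic are all proportional to one point moves,
under a derivation of the constants, only along its own image.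

The polynomial `φ ⬝ᵥ φ' ⨯₃ D φ`, divided by `G(φ)`, is the pullback of the logarithmic two-form with
pole along the cubic. Its residue at a root of `G(φ)` is the multiplicity of the root times a
number `-c` depending only on the point `p`, so that the sum of the residues is `-3nc`. -/
theorem triple_eq_zero [CharZero K] {n : ℕ} (hn : 0 < n) {G : MvPolynomial (Fin 3) K}
    (hG : G.IsHomogeneous 3) (hGD : mvCoeffs D G = 0) {φ : Fin 3 → K[X]}
    (hφ : ∀ i, (φ i).natDegree ≤ n) (hsplit : (aeval φ G).Splits)
    (hdeg : (aeval φ G).natDegree = 3 * n) {p : Fin 3 → K} (hp : eval p G = 0)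
    (hsm : ∃ i, eval p (pderiv i G) ≠ 0)
    (hφp : ∀ a, (aeval φ G).IsRoot a → ∃ r : K, r ≠ 0 ∧ ∀ i, (φ i).eval a = r * p i) :
    φ ⬝ᵥ (fun i => Polynomial.derivative (φ i)) ⨯₃ (fun i => polyCoeffs D (φ i)) = 0 := by
  set g := aeval φ G with hg
  have hg0 : g ≠ 0 := by
    rintro h
    rw [h, Polynomial.natDegree_zero] at hdeg
    omega
  obtain ⟨c, hc⟩ : ∃ c : K, ∀ i, (p ⨯₃ fun j => D (p j)) i = c * eval p (pderiv i G) := by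
    refine exists_cross_eq_smul hsm ?_ ?_
    · have h := congrArg (eval p) hG.sum_X_mul_pderiv
      simp only [map_sum, map_mul, eval_X, map_nsmul, hp, smul_zero] at h
      simpa only [dotProduct, mul_comm] using h
    · have h := gradAlong_dotProduct_polyCoeffs D G (fun i => Polynomial.C (p i))
      rw [hGD, map_zero, sub_zero] at h
      have h' := congrArg (Polynomial.eval 0) h
      have h0 : aeval (fun i => Polynomial.C (p i)) G = 0 := by
        have h0 := aeval_algebraMap_apply K[X] p G
        rw [aeval_eq_eval, hp, map_zero] at h0
        exact h0
      rw [h0, map_zero] at h'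
      simpa [dotProduct, Polynomial.eval_finsetSum, eval_gradAlong, polyCoeffs_C] using h'
  set N := φ ⬝ᵥ (fun i => Polynomial.derivative (φ i)) ⨯₃ (fun i => polyCoeffs D (φ i)) with hN
  have hNdeg : N.natDegree < 3 * n - 1 := natDegree_triple_lt hn hφ fun i =>
    (natDegree_polyCoeffs_le D _).trans (hφ i)
  have hdvd : g ∣ N + Polynomial.C c * Polynomial.derivative g := by
    refine dvd_of_forall_X_sub_C_pow_dvd hsplit hg0 fun a => ?_
    by_cases ha : g.IsRoot a
    · obtain ⟨r, hr, hra⟩ := hφp a ha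
      have hgrad (i) : eval (fun j => (φ j).eval a) (pderiv i G) =
          r ^ 2 * eval p (pderiv i G) := by
        simp only [hra]
        exact eval_mul_of_isHomogeneous hG.pderiv r p
      refine X_sub_C_pow_dvd D hG hGD φ (Polynomial.pow_rootMultiplicity_dvd g a) ?_ fun i => ?_
      · obtain ⟨i, hi⟩ := hsm
        exact ⟨i, by rw [hgrad]; exact mul_ne_zero (pow_ne_zero 2 hr) hi⟩
      · rw [hgrad, mul_left_comm, ← hc]
        simp only [hra, Derivation.leibniz, smul_eq_mul, cross_apply]
        fin_cases i <;> simp <;> ring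
    · rw [Polynomial.rootMultiplicity_eq_zero ha, pow_zero]
      exact one_dvd _
  have hg' : (Polynomial.derivative g).natDegree ≤ 3 * n - 1 := by
    rw [← hdeg]
    exact Polynomial.natDegree_derivative_le g
  have hsum : N + Polynomial.C c * Polynomial.derivative g = 0 := by
    refine Polynomial.eq_zero_of_dvd_of_natDegree_lt hdvd ?_
    refine (Polynomial.natDegree_add_le_of_degree_le hNdeg.le
      ((Polynomial.natDegree_C_mul_le _ _).trans hg')).trans_lt ?_
    omega
  have hc0 : c = 0 := by
    have h := congrArg (fun f => Polynomial.coeff f (3 * n - 1)) hsum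
    simp only [Polynomial.coeff_add, Polynomial.coeff_C_mul, Polynomial.coeff_derivative,
      Polynomial.coeff_eq_zero_of_natDegree_lt hNdeg, Polynomial.coeff_zero, zero_add] at h
    rw [show 3 * n - 1 + 1 = 3 * n by omega] at h
    have h3 : ((3 * n - 1 : ℕ) : K) + 1 ≠ 0 := Nat.cast_add_one_ne_zero _
    have hl : g.coeff (3 * n) ≠ 0 := by
      rw [← hdeg]
      exact Polynomial.leadingCoeff_ne_zero.2 hg0
    simpa [hl, h3] using h
  simpa [hc0] using hsum

/-- The path is an immersion at its generic point: otherwise `G(φ)' φ = 3 G(φ) φ'`, and comparing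
the orders at a root of `G(φ)`, all the coordinates of `φ` would vanish there. -/
theorem cross_derivative_ne_zero [CharZero K] {G : MvPolynomial (Fin 3) K}
    (hG : G.IsHomogeneous 3) {φ : Fin 3 → K[X]} (hg0 : aeval φ G ≠ 0) {a : K}
    (ha : (aeval φ G).IsRoot a) {i : Fin 3} (hi : (φ i).eval a ≠ 0) :
    φ ⨯₃ (fun i => Polynomial.derivative (φ i)) ≠ 0 := by
  intro h
  set g := aeval φ G with hg
  have h1 := cross_cross_apply (gradAlong G φ) φ (fun i => Polynomial.derivative (φ i)) i
  rw [h, gradAlong_dotProduct_self hG, gradAlong_dotProduct_derivative] at h1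
  simp only [map_zero, Pi.zero_apply, ← hg] at h1
  have hpos := (Polynomial.rootMultiplicity_pos hg0).2 ha
  obtain ⟨l, hl⟩ : ∃ l, g.rootMultiplicity a = l + 1 := ⟨_, (Nat.sub_add_cancel hpos).symm⟩
  obtain ⟨u, hu, hua⟩ := Polynomial.exists_eq_pow_rootMultiplicity_mul_and_not_dvd g hg0 a
  rw [hl] at hu
  rw [Polynomial.dvd_iff_isRoot] at hua
  have h2 : ((Polynomial.X - Polynomial.C a) ^ l) * (((l : K[X]) + 1) * u * φ i) =
      ((Polynomial.X - Polynomial.C a) ^ l) * ((Polynomial.X - Polynomial.C a) *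
        (3 * u * Polynomial.derivative (φ i) - Polynomial.derivative u * φ i)) := by
    rw [hu] at h1
    simp [Polynomial.derivative_pow] at h1
    linear_combination -h1
  have h3 := mul_left_cancel₀ (pow_ne_zero l (Polynomial.X_sub_C_ne_zero a)) h2
  have h4 := congrArg (Polynomial.eval a) h3
  simp at h4
  have : (l : K) + 1 ≠ 0 := Nat.cast_add_one_ne_zero l
  tauto

/-- If a form vanishes on a path which moves only along its own image, then so does the
derivative of the form. -/
theorem aeval_mvCoeffs_eq_zero {φ : Fin 3 → K[X]}
    (hdet : φ ⬝ᵥ (fun i => Polynomial.derivative (φ i)) ⨯₃ (fun i => polyCoeffs D (φ i)) = 0)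
    (hcross : φ ⨯₃ (fun i => Polynomial.derivative (φ i)) ≠ 0)
    {F : MvPolynomial (Fin 3) K} {d : ℕ} (hF : F.IsHomogeneous d) (hFφ : aeval φ F = 0) :
    aeval φ (mvCoeffs D F) = 0 := by
  obtain ⟨i, hi⟩ := Function.ne_iff.1 hcross
  have h := triple_mul_apply φ (fun i => Polynomial.derivative (φ i))
    (fun i => polyCoeffs D (φ i)) (gradAlong F φ) i
  rw [hdet, gradAlong_dotProduct_self hF, gradAlong_dotProduct_derivative,
    gradAlong_dotProduct_polyCoeffs, hFφ] at h
  simp only [mul_zero, map_zero, zero_mul, zero_add, zero_sub, zero_eq_mul, neg_eq_zero] at h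
  exact h.resolve_right hi

end Core

/-! ### The degree of a parametrization -/

section TopCoefficient

theorem natDegree_prod_pow_le_and_coeff {σ R : Type*} [CommRing R] {L : σ → R[X]} {e : ℕ}
    (hL : ∀ i, (L i).natDegree ≤ e) (m : σ → ℕ) (s : Finset σ) :
    (∏ i ∈ s, L i ^ m i).natDegree ≤ (∑ i ∈ s, m i) * e ∧
      (∏ i ∈ s, L i ^ m i).coeff ((∑ i ∈ s, m i) * e) = ∏ i ∈ s, (L i).coeff e ^ m i := by
  classical
  induction s using Finset.induction_on with
  | empty => simp
  | insert a s ha ih =>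
    rw [Finset.prod_insert ha, Finset.sum_insert ha, Finset.prod_insert ha, add_mul]
    have h := Polynomial.natDegree_pow_le_of_le (m a) (hL a)
    refine ⟨Polynomial.natDegree_mul_le_of_le h ih.1, ?_⟩
    rw [Polynomial.coeff_mul_add_eq_of_natDegree_le h ih.1, ih.2,
      Polynomial.coeff_pow_of_natDegree_le (hL a)]

variable {σ R : Type*} [CommRing R] {P : MvPolynomial σ R} {d e : ℕ}
  {L : σ → R[X]}

theorem aeval_eq_sum (L : σ → R[X]) (P : MvPolynomial σ R) :
    aeval L P = ∑ m ∈ P.support, Polynomial.C (coeff m P) * ∏ i ∈ m.support, L i ^ m i := by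
  rw [aeval_def, eval₂_eq]
  rfl

theorem natDegree_aeval_le (hP : P.IsHomogeneous d) (hL : ∀ i, (L i).natDegree ≤ e) :
    (aeval L P).natDegree ≤ d * e := by
  rw [aeval_eq_sum]
  refine Polynomial.natDegree_sum_le_of_forall_le _ _ fun m hm => ?_
  refine (Polynomial.natDegree_C_mul_le _ _).trans ?_
  rw [hP.degree_eq_sum_deg_support hm]
  exact (natDegree_prod_pow_le_and_coeff hL m _).1

theorem coeff_aeval (hP : P.IsHomogeneous d) (hL : ∀ i, (L i).natDegree ≤ e) :
    (aeval L P).coeff (d * e) = eval (fun i => (L i).coeff e) P := by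
  rw [aeval_eq_sum, Polynomial.finsetSum_coeff, eval_eq]
  refine Finset.sum_congr rfl fun m hm => ?_
  rw [Polynomial.coeff_C_mul, hP.degree_eq_sum_deg_support hm,
    (natDegree_prod_pow_le_and_coeff hL m _).2]

end TopCoefficient

section LineCount

theorem exists_eval_ne_zero_and_ne_zero {F : MvPolynomial (Fin 3) ℂ} (hF0 : F ≠ 0) :
    ∃ o : Fin 3 → ℂ, o 0 ≠ 0 ∧ eval o F ≠ 0 := by
  by_contra! h
  have : X 0 * F = 0 := by
    refine MvPolynomial.funext fun o => ?_
    simpa [or_iff_not_imp_left] using h o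
  exact hF0 ((mul_eq_zero.1 this).resolve_left (X_ne_zero 0))

/-- A parametrization of degree `n` which is generically injective has image of degree at
least `n`: a general line through a point `o` off the curve meets the curve in `n` points. -/
theorem le_of_generically_injective {n d : ℕ} (hn : 0 < n) {φ : Fin 3 → ℂ[X]}
    (hφ : ∀ i, (φ i).natDegree ≤ n) (htop : (fun i => (φ i).coeff n) ≠ 0)
    (hφ0 : ∀ a, (fun i => (φ i).eval a) ≠ 0) {b : ℂ[X]} (hb : b ≠ 0)
    (hinj : ∀ s t, ¬ b.IsRoot s → ¬ b.IsRoot t →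
      (∃ c : ℂ, ∀ i, (φ i).eval t = c * (φ i).eval s) → s = t)
    {F : MvPolynomial (Fin 3) ℂ} (hF : F.IsHomogeneous d) (hF0 : F ≠ 0) (hFφ : aeval φ F = 0) :
    n ≤ d := by
  classical
  obtain ⟨o, ho, hFo⟩ := exists_eval_ne_zero_and_ne_zero hF0
  -- A point of the curve at which both linear forms of the pencil vanish is zero.
  have key (v : Fin 3 → ℂ) (hv : eval v F = 0) (h1 : o 0 * v 1 - o 1 * v 0 = 0)
      (h2 : o 0 * v 2 - o 2 * v 0 = 0) : v = 0 := by
    have hv' : v = fun i => v 0 / o 0 * o i := by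
      ext i
      fin_cases i
      · simp [ho]
      · simp
        field_simp
        linear_combination h1
      · simp
        field_simp
        linear_combination h2
    rw [hv', eval_mul_of_isHomogeneous hF] at hv
    have h0 : v 0 / o 0 = 0 := eq_zero_of_pow_eq_zero ((mul_eq_zero.1 hv).resolve_right hFo)
    rw [hv', h0]
    ext i
    simp
  have hev (a : ℂ) : eval (fun i => (φ i).eval a) F = 0 := by
    rw [← eval_aeval, hFφ, Polynomial.eval_zero]
  set P : ℂ[X] := Polynomial.C (o 0) * φ 1 - Polynomial.C (o 1) * φ 0 with hP
  set Q : ℂ[X] := Polynomial.C (o 0) * φ 2 - Polynomial.C (o 2) * φ 0 with hQ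
  have hdeg (x y : ℂ) (i j : Fin 3) :
      (Polynomial.C x * φ i - Polynomial.C y * φ j).natDegree ≤ n :=
    (Polynomial.natDegree_sub_le_of_le ((Polynomial.natDegree_C_mul_le _ _).trans (hφ i))
      ((Polynomial.natDegree_C_mul_le _ _).trans (hφ j))).trans (max_self n).le
  have hPQ (a : ℂ) : P.eval a ≠ 0 ∨ Q.eval a ≠ 0 := by
    by_contra! h
    exact hφ0 a (key _ (hev a) (by simpa [hP] using h.1) (by simpa [hQ] using h.2))
  have hPQn : P.coeff n ≠ 0 ∨ Q.coeff n ≠ 0 := by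
    by_contra! h
    refine htop (key _ ?_ (by simpa [hP] using h.1) (by simpa [hQ] using h.2))
    rw [← coeff_aeval hF hφ, hFφ, Polynomial.coeff_zero]
  obtain ⟨c, hT, hnodup, hroots⟩ :=
    exists_nodup_roots_add_C_mul hn (hdeg _ _ _ _) (hdeg _ _ _ _) hPQn hPQ hb
  rw [← hP, ← hQ] at hT hnodup hroots
  set T := P + Polynomial.C c * Q with hTdef
  have hT0 : T ≠ 0 := by
    rintro h
    rw [h, Polynomial.natDegree_zero] at hT
    omega
  -- The equation of the curve on the line through `o` and `(0, -c, 1)`.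
  set L : Fin 3 → ℂ[X] := fun i =>
    Polynomial.C ((![0, -c, 1] : Fin 3 → ℂ) i) + Polynomial.C (o i) * Polynomial.X with hL
  have hLdeg : ∀ i, (L i).natDegree ≤ 1 := fun i => by
    simp only [hL]
    compute_degree
  set f := aeval L F with hf
  have hfdeg : f.natDegree ≤ d := by simpa using natDegree_aeval_le hF hLdeg
  have hf0 : f ≠ 0 := by
    intro h
    have := coeff_aeval hF hLdeg
    rw [← hf, h, Polynomial.coeff_zero] at this
    refine hFo ?_
    rw [this]
    congr 2
    ext i
    simp [hL, Polynomial.coeff_C]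
  have hQ0 (a : ℂ) (ha : a ∈ T.roots.toFinset) : Q.eval a ≠ 0 := by
    rw [Multiset.mem_toFinset, Polynomial.mem_roots hT0] at ha
    intro h
    have h' : P.eval a = 0 := by simpa [hTdef, h] using ha
    have := hPQ a
    tauto
  have hline (a : ℂ) (ha : a ∈ T.roots.toFinset) (i : Fin 3) :
      (φ i).eval a = Q.eval a / o 0 * (L i).eval ((φ 0).eval a / Q.eval a) := by
    have hq := hQ0 a ha
    rw [Multiset.mem_toFinset, Polynomial.mem_roots hT0] at ha
    have hPa : P.eval a = -c * Q.eval a := by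
      have : P.eval a + c * Q.eval a = 0 := by simpa [hTdef] using ha
      linear_combination this
    have hP' : P.eval a = o 0 * (φ 1).eval a - o 1 * (φ 0).eval a := by simp [hP]
    have hQ' : Q.eval a = o 0 * (φ 2).eval a - o 2 * (φ 0).eval a := by simp [hQ]
    simp only [hL]
    fin_cases i
    · simp
      field_simp
    · simp
      field_simp
      linear_combination hPa - hP'
    · simp
      field_simp
      linear_combination -hQ'
  calc n = T.roots.toFinset.card := by
        rw [Multiset.toFinset_card_of_nodup hnodup, ← hT]
        exact (IsAlgClosed.splits T).natDegree_eq_card_roots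
    _ ≤ f.roots.toFinset.card := by
        refine Finset.card_le_card_of_injOn (fun a => (φ 0).eval a / Q.eval a) ?_ ?_
        · intro a ha
          have hq := div_ne_zero (hQ0 a ha) ho
          simp only [Finset.mem_coe, Multiset.mem_toFinset]
          rw [Polynomial.mem_roots hf0, Polynomial.IsRoot.def, hf, eval_aeval]
          have := hev a
          rw [funext (hline a ha), eval_mul_of_isHomogeneous hF] at this
          simpa [hq] using this
        · intro s hs t ht hst
          refine hinj s t (hroots s (by simpa using hs)) (hroots t (by simpa using ht))
            ⟨Q.eval t / o 0 / (Q.eval s / o 0), fun i => ?_⟩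
          have hq := div_ne_zero (hQ0 s hs) ho
          simp only at hst
          rw [hline s hs i, hline t ht i, hst, ← mul_assoc, div_mul_cancel₀ _ hq]
    _ ≤ f.roots.card := Multiset.toFinset_card_le _
    _ ≤ f.natDegree := Polynomial.card_roots' f
    _ ≤ d := hfdeg

end LineCount

/-! ### Affine parametrizations of rational curves -/

section Dehomogenization

/-- The affine parametrization `s ↦ s u + w` of the projective line punctured at `u`. -/
noncomputable def affineLine (u w : Fin 2 → ℂ) : Fin 2 → ℂ[X] :=
  fun j => Polynomial.C (u j) * Polynomial.X + Polynomial.C (w j)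

theorem natDegree_affineLine_le (u w : Fin 2 → ℂ) (j : Fin 2) :
    (affineLine u w j).natDegree ≤ 1 := by
  simp only [affineLine]
  compute_degree

theorem eval_affineLine (u w : Fin 2 → ℂ) (j : Fin 2) (s : ℂ) :
    (affineLine u w j).eval s = u j * s + w j := by
  simp [affineLine]

/-- A binary form is determined by its dehomogenization. -/
theorem eq_zero_of_aeval_affineLine {u w : Fin 2 → ℂ} (huw : u 0 * w 1 - u 1 * w 0 ≠ 0)
    {Q : MvPolynomial (Fin 2) ℂ} {n : ℕ} (hQ : Q.IsHomogeneous n)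
    (h : aeval (affineLine u w) Q = 0) : Q = 0 := by
  have hmul : (C (u 0) * X 1 - C (u 1) * X 0) * Q = 0 := by
    refine MvPolynomial.funext fun v => ?_
    simp only [map_mul, map_sub, eval_C, eval_X, map_zero, mul_eq_zero]
    by_cases hv : u 0 * v 1 - u 1 * v 0 = 0
    · exact Or.inl hv
    · right
      have hs := eval_aeval Q (affineLine u w) ((v 0 * w 1 - v 1 * w 0) / (u 0 * v 1 - u 1 * v 0))
      rw [h, Polynomial.eval_zero] at hs
      have hv' : v = fun j => (u 0 * v 1 - u 1 * v 0) / (u 0 * w 1 - u 1 * w 0) *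
          (affineLine u w j).eval ((v 0 * w 1 - v 1 * w 0) / (u 0 * v 1 - u 1 * v 0)) := by
        have hdiv (x y : ℂ) : (u 0 * v 1 - u 1 * v 0) / (u 0 * w 1 - u 1 * w 0) *
            (x * ((v 0 * w 1 - v 1 * w 0) / (u 0 * v 1 - u 1 * v 0)) + y) =
            (x * (v 0 * w 1 - v 1 * w 0) + y * (u 0 * v 1 - u 1 * v 0)) /
              (u 0 * w 1 - u 1 * w 0) := by
          generalize u 0 * v 1 - u 1 * v 0 = δ at *
          generalize u 0 * w 1 - u 1 * w 0 = η at *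
          field_simp
        ext j
        rw [eval_affineLine, hdiv, eq_div_iff huw]
        fin_cases j
        · simp
          ring
        · simp
          ring
      rw [hv', eval_mul_of_isHomogeneous hQ, ← hs, mul_zero]
  refine (mul_eq_zero.1 hmul).resolve_left fun h0 => huw ?_
  have := congrArg (eval w) h0
  simpa using this

theorem aeval_aeval {σ τ S : Type*} [CommRing S] [Algebra ℂ S] (P : MvPolynomial σ ℂ)
    (f : σ → MvPolynomial τ ℂ) (L : τ → S) :
    aeval L (aeval f P) = aeval (fun i => aeval L (f i)) P := by
  induction P using MvPolynomial.induction_on with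
  | C b => simp
  | add P Q hP hQ => simp only [map_add, hP, hQ]
  | mul_X P j hP => simp only [map_mul, aeval_X, hP]

theorem eval_aeval_form {σ τ : Type*} (P : MvPolynomial σ ℂ)
    (f : σ → MvPolynomial τ ℂ) (u : τ → ℂ) :
    eval u (aeval f P) = eval (fun i => eval u (f i)) P := by
  have := aeval_aeval P f u
  simpa only [aeval_eq_eval] using this

end Dehomogenization

namespace IsBirationalParametrization

variable {φ : Fin 3 → MvPolynomial (Fin 2) ℂ} {C : Set ProjPlane}

theorem mk_mem (h : IsBirationalParametrization φ C) {u : Fin 2 → ℂ} (hu : u ≠ 0) :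
    Projectivization.mk ℂ (fun i => eval u (φ i)) (h.no_common_zero u hu) ∈ C :=
  (Set.ext_iff.1 h.image_eq _).2 ⟨u, hu, rfl⟩

theorem aeval_eq_zero (h : IsBirationalParametrization φ C) {F : MvPolynomial (Fin 3) ℂ} {d : ℕ}
    (hF : F.IsHomogeneous d) (hC : C ⊆ locus F) : aeval φ F = 0 := by
  have hX : X 0 * aeval φ F = 0 := by
    refine MvPolynomial.funext fun u => ?_
    by_cases hu : u = 0
    · simp [hu]
    · have := (mk_mem_locus hF _ _).1 (hC (h.mk_mem hu))
      rw [← eval_aeval_form] at this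
      rw [map_mul, this, mul_zero, map_zero]
  exact (mul_eq_zero.1 hX).resolve_left (X_ne_zero 0)

/-- A birational parametrization is not constant. -/
theorem not_forall_proportional (h : IsBirationalParametrization φ C) (v : Fin 3 → ℂ) :
    ¬ ∀ u : Fin 2 → ℂ, u ≠ 0 → ∃ c : ℂ, ∀ i, eval u (φ i) = c * v i := by
  intro hv
  obtain ⟨m, ψ, hψ, ⟨j, hj⟩, hinv⟩ := h.exists_inverse
  have key (u : Fin 2 → ℂ) (hu : u ≠ 0) : ∃ c : ℂ, c ≠ 0 ∧
      ∀ j, eval u (aeval φ (ψ j)) = c ^ m * eval v (ψ j) := by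
    obtain ⟨c, hc⟩ := hv u hu
    refine ⟨c, ?_, fun j => ?_⟩
    · rintro rfl
      exact h.no_common_zero u hu (by ext i; simp [hc])
    · rw [eval_aeval_form, funext hc, eval_mul_of_isHomogeneous (hψ j)]
  have hrel (u : Fin 2 → ℂ) (hu : u ≠ 0) : eval v (ψ 0) * u 1 = eval v (ψ 1) * u 0 := by
    obtain ⟨c, hc, hcu⟩ := key u hu
    have := congrArg (eval u) hinv
    simp only [map_mul, eval_X, hcu] at this
    exact mul_left_cancel₀ (pow_ne_zero m hc) (by linear_combination this)
  have h0 : eval v (ψ 0) = 0 := by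
    simpa using hrel ![0, 1] (by simp)
  have h1 : eval v (ψ 1) = 0 := by
    simpa using (hrel ![1, 0] (by simp)).symm
  have hψv (j : Fin 2) : eval v (ψ j) = 0 := by
    fin_cases j
    · exact h0
    · exact h1
  have hX : X 0 * aeval φ (ψ j) = 0 := by
    refine MvPolynomial.funext fun u => ?_
    by_cases hu : u = 0
    · simp [hu]
    · obtain ⟨c, -, hcu⟩ := key u hu
      rw [map_mul, hcu, hψv, mul_zero, mul_zero, map_zero]
  exact hj ((mul_eq_zero.1 hX).resolve_left (X_ne_zero 0))

/-- Forms vanishing along the parametrization of an irreducible curve are multiples of its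
equation. -/
theorem exists_eq_C_mul {F H : MvPolynomial (Fin 3) ℂ} {d : ℕ}
    (h : IsBirationalParametrization φ (locus F)) (hd : d ≠ 0) (hF : F.IsHomogeneous d)
    (hirr : Irreducible F) (hH : H.IsHomogeneous d) (hHφ : aeval φ H = 0) :
    ∃ z : ℂ, H = MvPolynomial.C z * F := by
  have hprime : (Ideal.span {F}).IsPrime :=
    (Ideal.span_singleton_prime hirr.ne_zero).2 hirr.prime
  have hmem : H ∈ vanishingIdeal ℂ (zeroLocus ℂ (Ideal.span {F})) := by
    rw [mem_vanishingIdeal_iff]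
    intro v hv
    have hv' : eval v F = 0 := by
      have := hv F (Ideal.mem_span_singleton_self F)
      rwa [aeval_eq_eval] at this
    rw [aeval_eq_eval]
    by_cases hv0 : v = 0
    · have := eval_smul_of_isHomogeneous hH 0 v
      rwa [zero_pow hd, zero_mul, zero_smul, ← hv0] at this
    · have hloc := (mk_mem_locus hF v hv0).2 hv'
      rw [h.image_eq] at hloc
      obtain ⟨u, hu, hvu⟩ := hloc
      obtain ⟨a, ha⟩ := (Projectivization.mk_eq_mk_iff' ℂ _ _ _ _).1 hvu
      rw [← ha, eval_smul_of_isHomogeneous hH, ← eval_aeval_form, hHφ, map_zero, mul_zero]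
  rw [IsPrime.vanishingIdeal_zeroLocus, Ideal.mem_span_singleton] at hmem
  obtain ⟨Q, rfl⟩ := hmem
  by_cases hQ : Q = 0
  · exact ⟨0, by simp [hQ]⟩
  · have hdeg := hH.totalDegree (mul_ne_zero hirr.ne_zero hQ)
    rw [totalDegree_mul_of_isDomain hirr.ne_zero hQ, hF.totalDegree hirr.ne_zero] at hdeg
    have hQ0 : Q.totalDegree = 0 := by omega
    exact ⟨_, by rw [← totalDegree_eq_zero_iff_eq_C.1 hQ0, mul_comm]⟩

end IsBirationalParametrization

/-- `φ` is an affine parametrization of degree `n` of the rational curve `F = 0` of degree `d`,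
whose point at infinity does not lie on the cubic `G = 0`, and which meets the cubic only at
the point `p`. -/
structure IsAffineParametrization (G F : MvPolynomial (Fin 3) ℂ) (d n : ℕ) (φ : Fin 3 → ℂ[X])
    (p : Fin 3 → ℂ) : Prop where
  natDegree_le : ∀ i, (φ i).natDegree ≤ n
  natDegree_cubic : (aeval φ G).natDegree = 3 * n
  point_ne_zero : p ≠ 0
  eval_point : eval p G = 0
  eval_root : ∀ a, (aeval φ G).IsRoot a → ∃ r : ℂ, r ≠ 0 ∧ ∀ i, (φ i).eval a = r * p i
  aeval_eq_zero : aeval φ F = 0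
  exists_eq_C_mul : ∀ H : MvPolynomial (Fin 3) ℂ, H.IsHomogeneous d → aeval φ H = 0 →
    ∃ z : ℂ, H = C z * F

/-- Sending to infinity a point of the projective line whose image is not on the cubic gives an
affine parametrization. -/
theorem exists_isAffineParametrization {G F : MvPolynomial (Fin 3) ℂ} {d : ℕ}
    (hG : G.IsHomogeneous 3) (hF : IsRationalCurve d F) (hFG : MeetAtSinglePoint F G) :
    ∃ n, 0 < n ∧ n ≤ d ∧ ∃ φ p, IsAffineParametrization G F d n φ p := by
  obtain ⟨hFd, hirr, φ, hφ⟩ := hF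
  obtain ⟨p, hp⟩ := hFG
  obtain ⟨n, hn⟩ := hφ.exists_isHomogeneous
  have hpG : eval p.rep G = 0 := by
    have : p ∈ locus F ∩ locus G := by rw [hp]; rfl
    exact this.2
  have hprop (u : Fin 2 → ℂ) (hu : u ≠ 0) (huG : eval (fun i => eval u (φ i)) G = 0) :
      ∃ r : ℂ, r ≠ 0 ∧ ∀ i, eval u (φ i) = r * p.rep i := by
    have hmem : Projectivization.mk ℂ _ (hφ.no_common_zero u hu) ∈ locus F ∩ locus G :=
      ⟨hφ.mk_mem hu, (mk_mem_locus hG _ _).2 huG⟩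
    rw [hp, Set.mem_singleton_iff, ← p.mk_rep] at hmem
    obtain ⟨a, ha⟩ := (Projectivization.mk_eq_mk_iff ℂ _ _ _ _).1 hmem
    exact ⟨a, a.ne_zero, fun i => (congrFun ha i).symm⟩
  have hFφ0 : aeval φ F = 0 := hφ.aeval_eq_zero hFd subset_rfl
  have hn0 : 0 < n := by
    rw [Nat.pos_iff_ne_zero]
    rintro rfl
    refine hφ.not_forall_proportional (fun i => eval 0 (φ i)) fun u _ => ⟨1, fun i => ?_⟩
    have := eval_mul_of_isHomogeneous (hn i) 0 u
    simp only [zero_mul, pow_zero, one_mul] at this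
    rw [one_mul, ← this]
    rfl
  obtain ⟨u, hu, huG⟩ : ∃ u : Fin 2 → ℂ, u ≠ 0 ∧ eval (fun i => eval u (φ i)) G ≠ 0 := by
    by_contra! h
    exact hφ.not_forall_proportional p.rep fun u hu => (hprop u hu (h u hu)).imp fun _ hr => hr.2
  obtain ⟨w, huw⟩ : ∃ w : Fin 2 → ℂ, u 0 * w 1 - u 1 * w 0 ≠ 0 := by
    by_contra! h
    have h0 := h ![0, 1]
    have h1 := h ![1, 0]
    simp at h0 h1
    refine hu ?_
    ext i
    fin_cases i
    · exact h0
    · exact h1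
  set L := affineLine u w with hL
  have hLdeg := natDegree_affineLine_le u w
  have hL0 (s : ℂ) : (fun j => (L j).eval s) ≠ 0 := by
    intro h
    have h0 := congrFun h 0
    have h1 := congrFun h 1
    simp only [hL, eval_affineLine, Pi.zero_apply] at h0 h1
    exact huw (by linear_combination u 0 * h1 - u 1 * h0)
  have hLu : (fun j => (L j).coeff 1) = u := by
    ext j
    simp [hL, affineLine, Polynomial.coeff_C]
  set f : Fin 3 → ℂ[X] := fun i => aeval L (φ i) with hf
  have hfdeg (i) : (f i).natDegree ≤ n := by simpa using natDegree_aeval_le (hn i) hLdeg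
  have hftop : (fun i => (f i).coeff n) = fun i => eval u (φ i) := by
    ext i
    have := coeff_aeval (hn i) hLdeg
    rw [mul_one] at this
    rw [hf, ← hLu]
    exact this
  have hfeval (s : ℂ) : (fun i => (f i).eval s) = fun i => eval (fun j => (L j).eval s) (φ i) := by
    ext i
    exact eval_aeval _ _ _
  have hFf : aeval f F = 0 := by
    rw [hf, ← aeval_aeval, hFφ0, map_zero]
  -- Off the zeros of `ψ j (φ)`, the inverse `ψ` recovers the parameter from its image.
  have hnd : n ≤ d := by
    obtain ⟨m, ψ, hψ, ⟨j, hj⟩, hinv⟩ := hφ.exists_inverse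
    have hb : aeval f (ψ j) ≠ 0 := by
      rw [hf, ← aeval_aeval]
      exact fun h => hj (eq_zero_of_aeval_affineLine huw ((hψ j).aeval φ hn) h)
    refine le_of_generically_injective hn0 hfdeg (by rw [hftop]; exact hφ.no_common_zero u hu)
      (fun s => by rw [hfeval]; exact hφ.no_common_zero _ (hL0 s)) hb (fun s t hs _ hst => ?_)
      hFd hirr.ne_zero hFf
    obtain ⟨c, hc⟩ := hst
    have hinv' := congrArg (aeval L) hinv
    simp only [map_mul, aeval_X, aeval_aeval] at hinv'
    have hS := congrArg (Polynomial.eval s) hinv'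
    have hT := congrArg (Polynomial.eval t) hinv'
    have hc0 : c ≠ 0 := by
      rintro rfl
      refine hφ.no_common_zero _ (hL0 t) ?_
      rw [← hfeval]
      ext i
      simp [hc]
    have hψt (j) : (aeval f (ψ j)).eval t = c ^ m * (aeval f (ψ j)).eval s := by
      rw [eval_aeval, eval_aeval, funext hc, eval_mul_of_isHomogeneous (hψ j)]
    simp only [Polynomial.eval_mul, ← hf, hψt] at hS hT
    have hT' := mul_left_cancel₀ (pow_ne_zero m hc0)
      (show c ^ m * ((aeval f (ψ 0)).eval s * (L 1).eval t) =
        c ^ m * ((aeval f (ψ 1)).eval s * (L 0).eval t) by linear_combination hT)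
    simp only [hL, eval_affineLine] at hS hT'
    have hs' : (aeval f (ψ 0)).eval s ≠ 0 ∨ (aeval f (ψ 1)).eval s ≠ 0 := by
      fin_cases j
      · exact Or.inl hs
      · exact Or.inr hs
    have h0 : (aeval f (ψ 0)).eval s * ((s - t) * (u 0 * w 1 - u 1 * w 0)) = 0 := by
      linear_combination (u 0 * s + w 0) * hT' - (u 0 * t + w 0) * hS
    have h1 : (aeval f (ψ 1)).eval s * ((s - t) * (u 0 * w 1 - u 1 * w 0)) = 0 := by
      linear_combination (u 1 * s + w 1) * hT' - (u 1 * t + w 1) * hS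
    have hst : s - t = 0 := by
      simp only [mul_eq_zero, huw, or_false] at h0 h1
      tauto
    exact sub_eq_zero.1 hst
  refine ⟨n, hn0, hnd, f, p.rep, hfdeg, ?_, p.rep_nonzero, hpG, fun a ha => ?_, hFf,
    fun H hH hHf => ?_⟩
  · refine le_antisymm (natDegree_aeval_le hG hfdeg) (Polynomial.le_natDegree_of_ne_zero ?_)
    rw [coeff_aeval hG hfdeg, hftop]
    exact huG
  · rw [Polynomial.IsRoot.def, eval_aeval, hfeval] at ha
    obtain ⟨r, hr, hri⟩ := hprop _ (hL0 a) ha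
    exact ⟨r, hr, fun i => (congrFun (hfeval a) i).trans (hri i)⟩
  · refine hφ.exists_eq_C_mul (hn0.trans_le hnd).ne' hFd hirr hH ?_
    rw [hf, ← aeval_aeval] at hHf
    exact eq_zero_of_aeval_affineLine huw (hH.aeval φ hn) hHf

/-! ### Ultrapowers of the complex numbers -/

section Ultrapower

/-- The ideal of sequences that vanish almost everywhere with respect to an ultrafilter. -/
def eventuallyZero (U : Ultrafilter ℕ) : Ideal (ℕ → ℂ) where
  carrier := {r | ∀ᶠ k in (U : Filter ℕ), r k = 0}
  zero_mem' := Filter.Eventually.of_forall fun _ => rfl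
  add_mem' := fun {a b} (ha : ∀ᶠ k in (U : Filter ℕ), a k = 0)
      (hb : ∀ᶠ k in (U : Filter ℕ), b k = 0) => by
    show ∀ᶠ k in (U : Filter ℕ), (a + b) k = 0
    filter_upwards [ha, hb] with k h1 h2
    rw [Pi.add_apply, h1, h2, add_zero]
  smul_mem' := fun c a (ha : ∀ᶠ k in (U : Filter ℕ), a k = 0) => by
    show ∀ᶠ k in (U : Filter ℕ), (c • a) k = 0
    filter_upwards [ha] with k h
    rw [Pi.smul_apply', h, smul_zero]

theorem mem_eventuallyZero {U : Ultrafilter ℕ} {r : ℕ → ℂ} :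
    r ∈ eventuallyZero U ↔ ∀ᶠ k in (U : Filter ℕ), r k = 0 := Iff.rfl

theorem isMaximal_eventuallyZero (U : Ultrafilter ℕ) : (eventuallyZero U).IsMaximal := by
  rw [Ideal.isMaximal_iff]
  refine ⟨fun h => ?_, fun J x hJ hx hxJ => ?_⟩
  · obtain ⟨k, hk⟩ := (mem_eventuallyZero.1 h).exists
    exact one_ne_zero hk
  · rw [mem_eventuallyZero, ← Ultrafilter.eventually_not] at hx
    have h : 1 - x * x⁻¹ ∈ eventuallyZero U := by
      rw [mem_eventuallyZero]
      filter_upwards [hx] with k hk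
      simp [hk]
    have := J.add_mem (hJ h) (J.mul_mem_right x⁻¹ hxJ)
    rwa [sub_add_cancel] at this

/-- An ultrapower of the field of complex numbers. -/
theorem exists_ultrapower : ∃ (K : Type) (_ : Field K) (_ : Algebra ℂ K) (π : (ℕ → ℂ) →ₐ[ℂ] K),
    Function.Surjective π ∧
      ∀ r, π r = 0 ↔ ∀ᶠ k in (Filter.hyperfilter ℕ : Filter ℕ), r k = 0 := by
  have := isMaximal_eventuallyZero (Filter.hyperfilter ℕ)
  let _ : Field ((ℕ → ℂ) ⧸ eventuallyZero (Filter.hyperfilter ℕ)) := Ideal.Quotient.field _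
  exact ⟨(ℕ → ℂ) ⧸ eventuallyZero (Filter.hyperfilter ℕ), inferInstance, inferInstance,
    Ideal.Quotient.mkₐ ℂ _, Ideal.Quotient.mkₐ_surjective _ _,
    fun r => (Ideal.Quotient.eq_zero_iff_mem).trans mem_eventuallyZero⟩

end Ultrapower

section Sequences

theorem exists_polynomial_of_seq {n : ℕ} {f : ℕ → ℂ[X]} (hf : ∀ k, (f k).natDegree ≤ n) :
    ∃ P : (ℕ → ℂ)[X], P.natDegree ≤ n ∧ ∀ k, P.map (Pi.evalRingHom _ k) = f k := by
  refine ⟨∑ i ∈ Finset.range (n + 1), Polynomial.monomial i (fun k => (f k).coeff i), ?_,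
    fun k => ?_⟩
  · refine Polynomial.natDegree_sum_le_of_forall_le _ _ fun i hi => ?_
    exact (Polynomial.natDegree_monomial_le _).trans (Finset.mem_range_succ_iff.1 hi)
  · rw [Polynomial.map_sum, (f k).as_sum_range' (n + 1) (Nat.lt_succ_of_le (hf k))]
    refine Finset.sum_congr rfl fun i hi => ?_
    rw [Polynomial.map_monomial]
    congr 1

/-- Forms over rings `B k` lift simultaneously along maps `A → B k` once their coefficients do. For
the projections of `A = ℕ → ℂ` this turns a sequence of forms into one form over `A`. -/
theorem exists_form_of_coeff {σ A ι : Type*} [Fintype σ] [DecidableEq σ] [CommRing A] {d : ℕ}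
    {B : ι → Type*} [∀ k, CommRing (B k)] (f : ∀ k, A →+* B k) {P : ∀ k, MvPolynomial σ (B k)}
    (hP : ∀ k, (P k).IsHomogeneous d) (h : ∀ m, ∃ a, ∀ k, f k a = coeff m (P k)) :
    ∃ Q : MvPolynomial σ A, Q.IsHomogeneous d ∧ ∀ k, map (f k) Q = P k := by
  choose a ha using h
  have hmem (m : σ →₀ ℕ) : m ∈ Finset.finsuppAntidiag Finset.univ d ↔ m.degree = d := by
    rw [Finset.mem_finsuppAntidiag, Finsupp.degree_eq_sum]
    simp
  refine ⟨∑ m ∈ Finset.finsuppAntidiag Finset.univ d, monomial m (a m), ?_, fun k => ?_⟩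
  · exact IsHomogeneous.sum _ _ _ fun m hm => isHomogeneous_monomial _ ((hmem m).1 hm)
  · ext m
    rw [map_sum, coeff_sum]
    simp only [map_monomial, coeff_monomial, ha]
    rw [Finset.sum_ite_eq']
    split_ifs with h
    · rfl
    · exact ((hP k).coeff_eq_zero fun h' => h ((hmem m).2 h')).symm

variable {A B σ : Type*} [CommRing A] [CommRing B] (f : A →+* B)

theorem map_aeval_path (Φ : σ → A[X]) (P : MvPolynomial σ A) :
    (aeval Φ P).map f = aeval (fun i => (Φ i).map f) (map f P) := by
  induction P using MvPolynomial.induction_on with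
  | C b => simp
  | add P Q hP hQ => simp only [map_add, Polynomial.map_add, hP, hQ]
  | mul_X P j hP => simp only [map_mul, Polynomial.map_mul, aeval_X, map_X, hP]

theorem map_eval_apply (x : σ → A) (P : MvPolynomial σ A) :
    f (eval x P) = eval (fun i => f (x i)) (map f P) := by
  induction P using MvPolynomial.induction_on with
  | C b => simp
  | add P Q hP hQ => simp only [map_add, hP, hQ]
  | mul_X P j hP => simp only [map_mul, eval_X, map_X, hP]

theorem exists_eq_C_mul_prod {K : Type*} [Field K] [IsAlgClosed K] {g : K[X]} {N : ℕ}
    (hg : g.natDegree = N) : ∃ a : Fin N → K,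
      g = Polynomial.C g.leadingCoeff * ∏ j, (Polynomial.X - Polynomial.C (a j)) := by
  have hsplit := IsAlgClosed.splits g
  obtain ⟨l, hl⟩ := Quot.exists_rep g.roots
  have hl' : g.roots = (l : Multiset K) := hl.symm
  have hlen : l.length = N := by
    rw [← hg, hsplit.natDegree_eq_card_roots, hl', Multiset.coe_card]
  subst hlen
  refine ⟨fun j => l[j], ?_⟩
  conv_lhs => rw [hsplit.eq_prod_roots, hl', Multiset.map_coe, Multiset.prod_coe]
  congr 1
  exact (Fin.prod_univ_fun_getElem l (fun x => Polynomial.X - Polynomial.C x)).symm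

variable {K : Type*} [Field K] [Algebra ℂ K] {π : (ℕ → ℂ) →ₐ[ℂ] K}

/-- An identity between polynomials that holds over the ultrapower holds for almost all terms of
the sequence, because only finitely many coefficients are involved. -/
theorem eventually_map_eq_zero
    (hπ : ∀ r, π r = 0 ↔ ∀ᶠ k in (Filter.hyperfilter ℕ : Filter ℕ), r k = 0)
    {P : (ℕ → ℂ)[X]} (hP : P.map (π : (ℕ → ℂ) →+* K) = 0) :
    ∀ᶠ k in (Filter.hyperfilter ℕ : Filter ℕ), P.map (Pi.evalRingHom (fun _ => ℂ) k) = 0 := by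
  have h : ∀ᶠ k in (Filter.hyperfilter ℕ : Filter ℕ), ∀ i ∈ P.support, P.coeff i k = 0 := by
    rw [Filter.eventually_all_finset]
    intro i _
    rw [← hπ]
    have := congrArg (fun f => Polynomial.coeff f i) hP
    simpa using this
  filter_upwards [h] with k hk
  ext i
  by_cases hi : i ∈ P.support
  · simp [hk i hi]
  · simp [Polynomial.notMem_support_iff.1 hi]

theorem eventually_mvPolynomial_map_eq_zero
    (hπ : ∀ r, π r = 0 ↔ ∀ᶠ k in (Filter.hyperfilter ℕ : Filter ℕ), r k = 0)
    {P : MvPolynomial σ (ℕ → ℂ)}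
    (hP : map (π : (ℕ → ℂ) →+* K) P = 0) :
    ∀ᶠ k in (Filter.hyperfilter ℕ : Filter ℕ), map (Pi.evalRingHom (fun _ => ℂ) k) P = 0 := by
  have h : ∀ᶠ k in (Filter.hyperfilter ℕ : Filter ℕ), ∀ m ∈ P.support, coeff m P k = 0 := by
    rw [Filter.eventually_all_finset]
    intro m _
    rw [← hπ]
    have := congrArg (coeff m) hP
    simpa [coeff_map] using this
  filter_upwards [h] with k hk
  ext m
  rw [coeff_map, coeff_zero]
  by_cases hm : m ∈ P.support
  · exact hk m hm
  · rw [notMem_support_iff.1 hm, map_zero]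

end Sequences

/-! ### Finiteness -/

/-- There is no infinite sequence of distinct curves, with normalized equations, which are
parametrized in a fixed degree and meet the cubic at a single point: in the ultrapower, the
sequence would give such a curve whose equation is not defined over `ℂ`, and a derivation
over `ℂ` not killing its coefficients would move the curve. -/
theorem not_injective_of_isAffineParametrization {G : MvPolynomial (Fin 3) ℂ}
    (hG : IsSmoothCubic G) {d n : ℕ} (hn : 0 < n) {m : Fin 3 →₀ ℕ}
    {F : ℕ → MvPolynomial (Fin 3) ℂ} (hF : ∀ k, (F k).IsHomogeneous d)
    (hm : ∀ k, coeff m (F k) = 1) {φ : ℕ → Fin 3 → ℂ[X]} {p : ℕ → Fin 3 → ℂ}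
    (h : ∀ k, IsAffineParametrization G (F k) d n (φ k) (p k)) : ¬ Function.Injective F := by
  intro hinj
  obtain ⟨K, _, _, π, hsurj, hπ⟩ := exists_ultrapower
  have : CharZero K := charZero_of_injective_algebraMap (algebraMap ℂ K).injective
  have hne {r : ℕ → ℂ} (hr : ∀ k, r k ≠ 0) : π r ≠ 0 := fun h0 => by
    obtain ⟨k, hk⟩ := ((hπ r).1 h0).exists
    exact hr k hk
  let ev (k : ℕ) : (ℕ → ℂ) →+* ℂ := Pi.evalRingHom (fun _ => ℂ) k
  let πr : (ℕ → ℂ) →+* K := π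
  have hext {P Q : (ℕ → ℂ)[X]} (hPQ : ∀ k, P.map (ev k) = Q.map (ev k)) : P = Q := by
    ext i k
    have := congrArg (fun f => Polynomial.coeff f i) (hPQ k)
    simpa [ev] using this
  -- The sequences of parametrizations and of equations as objects over `ℕ → ℂ`.
  choose Φ hΦdeg hΦ using fun i => exists_polynomial_of_seq (n := n) (f := fun k => φ k i)
    fun k => (h k).natDegree_le i
  obtain ⟨P, hP, hPF⟩ := exists_form_of_coeff ev hF fun m => ⟨fun k => coeff m (F k), fun k => rfl⟩
  set G' : MvPolynomial (Fin 3) (ℕ → ℂ) := map (algebraMap ℂ (ℕ → ℂ)) G with hG'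
  have hG'ev (k) : map (ev k) G' = G := by
    rw [hG', map_map]
    exact map_id G
  have hπC (Q : MvPolynomial (Fin 3) ℂ) :
      map πr (map (algebraMap ℂ (ℕ → ℂ)) Q) = map (algebraMap ℂ K) Q := by
    rw [map_map]
    exact congrArg (fun f => map f Q) π.comp_algebraMap
  have hG'π : map πr G' = map (algebraMap ℂ K) G := by
    rw [hG', hπC]
  have hΦev (k : ℕ) (Q : MvPolynomial (Fin 3) (ℕ → ℂ)) :
      (aeval Φ Q).map (ev k) = aeval (φ k) (map (ev k) Q) := by
    rw [map_aeval_path]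
    congr 2
    ext1 i
    exact hΦ i k
  have hevalev (k : ℕ) (a : ℕ → ℂ) (i : Fin 3) : (Φ i).eval a k = (φ k i).eval (a k) := by
    rw [← hΦ i k]
    exact (Polynomial.eval_map_apply (ev k) a).symm
  -- Their images over the ultrapower.
  set φ' : Fin 3 → K[X] := fun i => (Φ i).map πr with hφ'
  set p' : Fin 3 → K := fun i => π (fun k => p k i) with hp'
  have hφ'deg (i) : (φ' i).natDegree ≤ n := Polynomial.natDegree_map_le.trans (hΦdeg i)
  have hGK : (map (algebraMap ℂ K) G).IsHomogeneous 3 := hG.isHomogeneous.map _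
  choose a ha using fun k => exists_eq_C_mul_prod (h k).natDegree_cubic
  have hg : aeval Φ G' = Polynomial.C (fun k => (aeval (φ k) G).leadingCoeff) *
      ∏ j, (Polynomial.X - Polynomial.C (fun k => a k j)) := by
    refine hext fun k => ?_
    rw [hΦev, hG'ev, ha k]
    simp [Polynomial.map_prod, ev]
  have hgK : aeval φ' (map (algebraMap ℂ K) G) =
      Polynomial.C (π (fun k => (aeval (φ k) G).leadingCoeff)) *
      ∏ j, (Polynomial.X - Polynomial.C (π (fun k => a k j))) := by
    rw [← hG'π, hφ', ← map_aeval_path, hg]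
    simp [Polynomial.map_prod, πr]
  have hlead : π (fun k => (aeval (φ k) G).leadingCoeff) ≠ 0 := hne fun k => by
    rw [Polynomial.leadingCoeff_ne_zero]
    intro h0
    have := (h k).natDegree_cubic
    rw [h0, Polynomial.natDegree_zero] at this
    omega
  have hg0 : aeval φ' (map (algebraMap ℂ K) G) ≠ 0 := by
    rw [hgK]
    exact mul_ne_zero (Polynomial.C_ne_zero.2 hlead)
      (Finset.prod_ne_zero_iff.2 fun j _ => Polynomial.X_sub_C_ne_zero _)
  have hgdeg : (aeval φ' (map (algebraMap ℂ K) G)).natDegree = 3 * n := by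
    rw [hgK, Polynomial.natDegree_C_mul hlead, Polynomial.natDegree_finsetProd_X_sub_C_eq_card]
    simp
  have hsplit : (aeval φ' (map (algebraMap ℂ K) G)).Splits := by
    rw [hgK]
    exact (Polynomial.Splits.C _).mul
      (Polynomial.Splits.prod fun j _ => Polynomial.Splits.X_sub_C _)
  have hroot (x : K) (hx : (aeval φ' (map (algebraMap ℂ K) G)).IsRoot x) :
      ∃ r : K, r ≠ 0 ∧ ∀ i, (φ' i).eval x = r * p' i := by
    rw [hgK, Polynomial.IsRoot.def, Polynomial.eval_mul, Polynomial.eval_C, Polynomial.eval_prod,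
      mul_eq_zero, or_iff_right hlead, Finset.prod_eq_zero_iff] at hx
    obtain ⟨j, -, hj⟩ := hx
    rw [Polynomial.eval_sub, Polynomial.eval_X, Polynomial.eval_C, sub_eq_zero] at hj
    have hr (k : ℕ) : ∃ r : ℂ, r ≠ 0 ∧ ∀ i, (φ k i).eval (a k j) = r * p k i := by
      refine (h k).eval_root _ ?_
      rw [ha k, Polynomial.IsRoot.def, Polynomial.eval_mul, Polynomial.eval_prod,
        Finset.prod_eq_zero (Finset.mem_univ j) (by simp), mul_zero]
    choose r hr0 hr using hr
    refine ⟨π r, hne hr0, fun i => ?_⟩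
    rw [hj, hφ', hp', ← map_mul]
    refine (Polynomial.eval_map_apply πr (fun k => a k j)).trans ?_
    refine congrArg π ?_
    ext k
    rw [hevalev, hr]
    rfl
  have hevalp (Q : MvPolynomial (Fin 3) ℂ) :
      eval p' (map (algebraMap ℂ K) Q) = π (fun k => eval (p k) Q) := by
    rw [← hπC, hp']
    refine (map_eval_apply πr (fun i k => p k i) _).symm.trans (congrArg π ?_)
    ext k
    refine (map_eval_apply (ev k) (fun i k => p k i) _).trans ?_
    rw [map_map]
    congr 1
    exact map_id Q
  have hpK : eval p' (map (algebraMap ℂ K) G) = 0 := by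
    rw [hevalp, hπ]
    exact Filter.Eventually.of_forall fun k => (h k).eval_point
  have hsm : ∃ i, eval p' (pderiv i (map (algebraMap ℂ K) G)) ≠ 0 := by
    by_contra! h0
    simp only [pderiv_map, hevalp, hπ] at h0
    obtain ⟨k, hk⟩ := (Filter.eventually_all.2 h0).exists
    obtain ⟨i, hi⟩ := hG.smooth (p k) (h k).point_ne_zero (h k).eval_point
    exact hi (hk i)
  have hp0 : ∃ i, p' i ≠ 0 := by
    by_contra! h0
    simp only [hp', hπ] at h0
    obtain ⟨k, hk⟩ := (Filter.eventually_all.2 h0).exists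
    exact (h k).point_ne_zero (funext hk)
  have hcross : φ' ⨯₃ (fun i => Polynomial.derivative (φ' i)) ≠ 0 := by
    have hx : (aeval φ' (map (algebraMap ℂ K) G)).IsRoot (π fun k => a k ⟨0, by omega⟩) := by
      rw [hgK, Polynomial.IsRoot.def, Polynomial.eval_mul, Polynomial.eval_prod,
        Finset.prod_eq_zero (Finset.mem_univ ⟨0, by omega⟩) (by simp), mul_zero]
    obtain ⟨r, hr, hri⟩ := hroot _ hx
    obtain ⟨i, hi⟩ := hp0
    exact cross_derivative_ne_zero hGK hg0 hx (i := i) (by rw [hri]; exact mul_ne_zero hr hi)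
  have hFK : aeval φ' (map πr P) = 0 := by
    rw [hφ', ← map_aeval_path, show aeval Φ P = 0 from hext fun k => by
      rw [hΦev, hPF, (h k).aeval_eq_zero, Polynomial.map_zero], Polynomial.map_zero]
  -- The equation over the ultrapower has a coefficient outside `ℂ`.
  obtain ⟨m', hm'⟩ : ∃ m', Transcendental ℂ (coeff m' (map πr P)) := by
    by_contra! h0
    have h1 (m') : ∃ z : ℂ, ∀ _ : Unit, algebraMap ℂ K z = coeff m' (map πr P) := by
      have halg := (not_not.1 (h0 m')).isIntegral
      obtain ⟨z, hz⟩ := minpoly.mem_range_of_degree_eq_one ℂ _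
        (IsAlgClosed.degree_eq_one_of_irreducible ℂ (minpoly.irreducible halg))
      exact ⟨z, fun _ => hz⟩
    obtain ⟨F₀, -, hF₀⟩ := exists_form_of_coeff (fun _ : Unit => algebraMap ℂ K)
      (fun _ => hP.map πr) h1
    have h2 : map πr (P - map (algebraMap ℂ (ℕ → ℂ)) F₀) = 0 := by
      rw [map_sub, hπC, ← hF₀ (), sub_self]
    have h3 := eventually_mvPolynomial_map_eq_zero hπ h2
    have h4 : {k | F k = F₀}.Finite := Set.Subsingleton.finite fun x hx y hy =>
      hinj (Eq.trans hx (Eq.symm hy))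
    obtain ⟨k, hk, hk'⟩ := (h3.and
      (Ultrafilter.eventually_not.2 (Filter.notMem_hyperfilter_of_finite h4))).exists
    refine hk' ?_
    rw [map_sub, map_map, sub_eq_zero] at hk
    exact (hPF k).symm.trans (hk.trans (map_id F₀))
  obtain ⟨D, hD⟩ := exists_derivation_ne_zero_of_transcendental hm'
  have hGD : mvCoeffs D (map (algebraMap ℂ K) G) = 0 := by
    ext m
    rw [coeff_mvCoeffs, coeff_map, D.map_algebraMap, coeff_zero]
  -- The derivative of the equation again vanishes on the curve, hence is a multiple of the
  -- equation; but its coefficient at the normalized monomial is zero.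
  have hDF := aeval_mvCoeffs_eq_zero D
    (triple_eq_zero D hn hGK hGD hφ'deg hsplit hgdeg hpK hsm hroot) hcross (hP.map πr) hFK
  obtain ⟨H, hH, hHD⟩ := exists_form_of_coeff (fun _ : Unit => πr)
    (fun _ => isHomogeneous_mvCoeffs D (hP.map πr)) fun m =>
      (hsurj (coeff m (mvCoeffs D (map πr P)))).imp fun _ hr _ => hr
  replace hHD := hHD ()
  have hHφ := eventually_map_eq_zero hπ (P := aeval Φ H) (by
    change (aeval Φ H).map πr = 0
    rw [map_aeval_path, hHD]
    exact hDF)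
  have hHm : ∀ᶠ k in (Filter.hyperfilter ℕ : Filter ℕ), coeff m H k = 0 := by
    rw [← hπ]
    have h1 : coeff m (map πr P) = 1 := by
      rw [coeff_map, show coeff m P = 1 from funext fun k => ?_, map_one]
      have := congrArg (coeff m) (hPF k)
      rw [coeff_map, hm] at this
      exact this
    have h2 := congrArg (coeff m) hHD
    rw [coeff_mvCoeffs, h1, D.map_one_eq_zero, coeff_map] at h2
    exact h2
  refine hD ?_
  rw [← coeff_mvCoeffs, ← hHD, coeff_map]
  change π (coeff m' H) = 0
  rw [hπ]
  filter_upwards [hHφ, hHm] with k hk hkm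
  have hk' : aeval (φ k) (map (ev k) H) = 0 := (hΦev k H).symm.trans hk
  obtain ⟨z, hz⟩ := (h k).exists_eq_C_mul _ (hH.map _) hk'
  have hz0 : z = 0 := by
    have := congrArg (coeff m) hz
    rw [coeff_map, coeff_C_mul, hm, mul_one] at this
    exact this.symm.trans hkm
  have := congrArg (coeff m') hz
  rw [hz0, C_0, zero_mul, coeff_map, coeff_zero] at this
  exact this

theorem locus_C_mul {z : ℂ} (hz : z ≠ 0) (F : MvPolynomial (Fin 3) ℂ) :
    locus (C z * F) = locus F := by
  ext p
  simp [locus, hz]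

theorem IsAffineParametrization.C_mul {G F : MvPolynomial (Fin 3) ℂ} {d n : ℕ} {φ : Fin 3 → ℂ[X]}
    {p : Fin 3 → ℂ} (h : IsAffineParametrization G F d n φ p) {z : ℂ} (hz : z ≠ 0) :
    IsAffineParametrization G (C z * F) d n φ p :=
  { h with
    aeval_eq_zero := by rw [map_mul, h.aeval_eq_zero, mul_zero]
    exists_eq_C_mul := fun H hH hHφ => by
      obtain ⟨w, hw⟩ := h.exists_eq_C_mul H hH hHφ
      exact ⟨w * z⁻¹, by
        rw [hw, ← mul_assoc, ← MvPolynomial.C_mul, mul_assoc, inv_mul_cancel₀ hz, mul_one]⟩ }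

/-- For every degree, there are only finitely many rational curves meeting a smooth cubic at a
single point. -/
theorem finite_rationalCurves {G : MvPolynomial (Fin 3) ℂ} (hG : IsSmoothCubic G) (d : ℕ) :
    {C : Set ProjPlane | ∃ F : MvPolynomial (Fin 3) ℂ,
      IsRationalCurve d F ∧ MeetAtSinglePoint F G ∧ C = locus F}.Finite := by
  let S (n : ℕ) (m : Fin 3 →₀ ℕ) : Set (Set ProjPlane) := {C | ∃ F φ p, F.IsHomogeneous d ∧
    coeff m F = 1 ∧ IsAffineParametrization G F d n φ p ∧ C = locus F}
  have hS (n : ℕ) (hn : 0 < n) (m : Fin 3 →₀ ℕ) : (S n m).Finite := by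
    by_contra hinf
    have e := Set.Infinite.natEmbedding _ hinf
    choose F φ p hF hm hp hC using fun k => (e k).2
    refine not_injective_of_isAffineParametrization hG hn hF hm hp fun i j hij => ?_
    exact e.injective (Subtype.ext (by rw [hC, hC, hij]))
  refine ((Set.finite_Icc 1 d).biUnion fun n hn =>
    (Finset.finsuppAntidiag (Finset.univ : Finset (Fin 3)) d).finite_toSet.biUnion fun m _ =>
      hS n hn.1 m).subset ?_
  rintro _ ⟨F, hF, hFG, rfl⟩
  obtain ⟨n, hn, hnd, φ, p, h⟩ := exists_isAffineParametrization hG.isHomogeneous hF hFG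
  obtain ⟨m, hm⟩ := ne_zero_iff.1 hF.irreducible.ne_zero
  have hmd : m ∈ Finset.finsuppAntidiag (Finset.univ : Finset (Fin 3)) d := by
    have hdeg : m.degree = d := by
      by_contra h0
      exact hm (hF.isHomogeneous.coeff_eq_zero h0)
    rw [Finsupp.degree_eq_sum] at hdeg
    simp [Finset.mem_finsuppAntidiag, hdeg]
  simp only [Set.mem_iUnion]
  refine ⟨n, ⟨hn, hnd⟩, m, hmd, C (coeff m F)⁻¹ * F, φ, p, hF.isHomogeneous.C_mul _, ?_,
    h.C_mul (inv_ne_zero hm), (locus_C_mul (inv_ne_zero hm) F).symm⟩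
  rw [coeff_C_mul, inv_mul_cancel₀ hm]

/-! ### Families -/

/-- Nullstellensatz: a nonzero regular function on an affine variety has a nonzero value. -/
theorem exists_algHom_ne_zero {A : Type*} [CommRing A] [IsDomain A] [Algebra ℂ A]
    [Algebra.FiniteType ℂ A] {a : A} (ha : a ≠ 0) : ∃ b : A →ₐ[ℂ] ℂ, b a ≠ 0 := by
  have : IsJacobsonRing A := isJacobsonRing_of_finiteType (A := ℂ)
  have hjac : (⊥ : Ideal A).jacobson = ⊥ :=
    IsJacobsonRing.out inferInstance Ideal.isRadical_bot
  obtain ⟨M, hM, haM⟩ : ∃ M : Ideal A, M.IsMaximal ∧ a ∉ M := by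
    by_contra! h
    refine ha ?_
    rw [← Ideal.mem_bot, ← hjac, Ideal.jacobson, Submodule.mem_sInf]
    exact fun J hJ => h J hJ.2
  let _ : Field (A ⧸ M) := Ideal.Quotient.field M
  have : Module.Finite ℂ (A ⧸ M) := finite_of_finite_type_of_isJacobsonRing ℂ (A ⧸ M)
  let e : ℂ ≃ₐ[ℂ] A ⧸ M := AlgEquiv.ofBijective (Algebra.ofId ℂ _)
    (IsAlgClosed.algebraMap_bijective_of_isIntegral (k := ℂ) (K := A ⧸ M))
  refine ⟨(e.symm : A ⧸ M →ₐ[ℂ] ℂ).comp (Ideal.Quotient.mkₐ ℂ M), fun h => haM ?_⟩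
  rw [← Ideal.Quotient.eq_zero_iff_mem]
  exact e.symm.map_eq_zero_iff.1 h

theorem IsRationalCurve.exists_eq_C_mul {F H : MvPolynomial (Fin 3) ℂ} {d : ℕ}
    (hF : IsRationalCurve d F) (hH : H.IsHomogeneous d) (hd : d ≠ 0)
    (hFH : locus F ⊆ locus H) : ∃ z : ℂ, H = C z * F := by
  obtain ⟨φ, hφ⟩ := hF.exists_parametrization
  exact hφ.exists_eq_C_mul hd hF.isHomogeneous hF.irreducible hH (hφ.aeval_eq_zero hH hFH)

/-- The closed conditions "`b` parametrizes the curve `C`", for the finitely many curves `C` that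
occur, cover an irreducible base; so one of them holds everywhere. -/
theorem not_isPositiveDimensional {G : MvPolynomial (Fin 3) ℂ} (hG : IsSmoothCubic G) {d : ℕ}
    {A : Type*} [CommRing A] [IsDomain A] [Algebra ℂ A] [Algebra.FiniteType ℂ A] (S : Family d A)
    (hS : ∀ b : A →ₐ[ℂ] ℂ, IsRationalCurve d (S.member b) ∧ MeetAtSinglePoint (S.member b) G) :
    ¬ S.IsPositiveDimensional := by
  rintro ⟨b₁, b₂, hb⟩
  have hd : d ≠ 0 := by
    obtain ⟨n, hn, hnd, -⟩ := exists_isAffineParametrization hG.isHomogeneous (hS b₁).1 (hS b₁).2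
    omega
  have hfin : (Set.range fun b => locus (S.member b)).Finite := by
    refine (finite_rationalCurves hG d).subset ?_
    rintro _ ⟨b, rfl⟩
    exact ⟨_, (hS b).1, (hS b).2, rfl⟩
  have := hfin.fintype
  choose β hβ using fun C : Set.range fun b => locus (S.member b) => C.2
  -- The equations saying that `S.member b` is proportional to the equation of `C`.
  let minor (C : Set.range fun b => locus (S.member b)) (m m' : Fin 3 →₀ ℕ) : A :=
    coeff m S.form * algebraMap ℂ A (coeff m' (S.member (β C))) -
      coeff m' S.form * algebraMap ℂ A (coeff m (S.member (β C)))
  have hminor (C m m') (b : A →ₐ[ℂ] ℂ) : b (minor C m m') =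
      coeff m (S.member b) * coeff m' (S.member (β C)) -
        coeff m' (S.member b) * coeff m (S.member (β C)) := by
    simp only [minor, map_sub, map_mul, AlgHom.commutes, Algebra.algebraMap_self, RingHom.id_apply]
    simp only [Family.member, coeff_map]
    rfl
  have hhom (b) : (S.member b).IsHomogeneous d := S.isHomogeneous.map _
  obtain ⟨C, hC⟩ : ∃ C, ∀ m m', minor C m m' = 0 := by
    by_contra! h
    choose m m' hm using h
    obtain ⟨b, hb⟩ := exists_algHom_ne_zero (Finset.prod_ne_zero_iff.2 fun C
      (_ : C ∈ Finset.univ) => hm C)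
    rw [map_prod, Finset.prod_ne_zero_iff] at hb
    refine hb ⟨_, b, rfl⟩ (Finset.mem_univ _) ?_
    obtain ⟨z, hz⟩ := (hS (β ⟨_, b, rfl⟩)).1.exists_eq_C_mul (hhom b) hd (hβ ⟨_, b, rfl⟩).le
    rw [hminor, hz, coeff_C_mul, coeff_C_mul]
    ring
  have hlocus (b) : locus (S.member b) = C := by
    obtain ⟨m', hm'⟩ := ne_zero_iff.1 (hS (β C)).1.irreducible.ne_zero
    have hz : S.member b =
        MvPolynomial.C (coeff m' (S.member b) / coeff m' (S.member (β C))) *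
          S.member (β C) := by
      ext m
      have := hminor C m m' b
      rw [hC, map_zero] at this
      rw [coeff_C_mul, div_mul_eq_mul_div, eq_div_iff hm']
      linear_combination -this
    have hz0 : coeff m' (S.member b) / coeff m' (S.member (β C)) ≠ 0 := by
      intro h0
      rw [h0, C_0, zero_mul] at hz
      exact (hS b).1.irreducible.ne_zero hz
    rw [hz, locus_C_mul hz0]
    exact hβ C
  exact hb (by rw [hlocus, hlocus])

end PlaneCurve

theorem mainTheorem8 (G : MvPolynomial (Fin 3) ℂ) (hG : PlaneCurve.IsSmoothCubic G) :
    (¬ ∃ (d : ℕ) (A : Type*) (_ : CommRing A) (_ : IsDomain A) (_ : Algebra ℂ A)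
        (_ : Algebra.FiniteType ℂ A) (S : PlaneCurve.Family d A),
        (∀ b : A →ₐ[ℂ] ℂ, PlaneCurve.IsRationalCurve d (S.member b) ∧
          PlaneCurve.MeetAtSinglePoint (S.member b) G) ∧
        S.IsPositiveDimensional) ∧
    (∀ d : ℕ, {C : Set PlaneCurve.ProjPlane | ∃ F : MvPolynomial (Fin 3) ℂ,
        PlaneCurve.IsRationalCurve d F ∧ PlaneCurve.MeetAtSinglePoint F G ∧
        C = PlaneCurve.locus F}.Finite) := by
  refine ⟨?_, PlaneCurve.finite_rationalCurves hG⟩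
  rintro ⟨d, A, _, _, _, _, S, hS, hpos⟩
  exact PlaneCurve.not_isPositiveDimensional hG S hS hpos
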